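/- Setting. Consider a power network with buses $1,\dots,n_b$ and $n$ branches, branch $l$ joining the distinct buses $i_l$ and $j_l$. Let $A\in\mathbb R^{n\times n_b}$ be its branch-bus incidence matrix (row $l$ has entry $1$ at $i_l$, $-1$ at $j_l$ and $0$ elsewhere), and let $\mathcal E$ be the set of pairs $(i,j)$ of buses that are connected by a branch. For branch admittances $Y\in\mathbb R^n$ and injected power $P\in\mathbb R^{n_b}$ put $$P_{ij}(Y,P)=e_i^TA^T\mathrm{diag}(Y)Ae_j\,(e_i-e_j)^T\left(A^T\mathrm{diag}(Y)A\right)^{-1^*}P ,$$ where $(\cdot)^{-1^*}$ is obtained by deleting, in every connected component of the network of branches with nonzero admittance, the row and column of a reference bus (the one of smallest index), inverting what remains, and filling the deleted entries with zeros. Let $P^0\in\mathbb R^{n_b}$ be the original injected power, $Y^0$ the original admittances, $\delta$ the initial disturbance, $Y^1=Y^0+\delta$, and for $k\ge 1$ let $Y^{k+1}_l=g(P_{i_lj_l}(Y^k,P^0),c_{i_lj_l})\,Y^k_l$, where, for the tunable parameter $\sigma$ of the cascading model, $g(x,c)=0$ if $|x|\ge\sqrt{c^2+\frac{\pi}{2\sigma}}$,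 $g(x,c)=1$ if $|x|\le\sqrt{c^2-\frac{\pi}{2\sigma}}$, and $g(x,c)=\frac12\left(1-\sin\sigma(x^2-c^2)\right)$ otherwise. Fix a cascading step $m$ and write $P^m_{ij}=P_{ij}(Y^m,P)$, a linear function of $P$. Given weights $W_i>0$, thresholds $\sigma_{ij}>0$ for $(i,j)\in\mathcal E$ and bounds $\underline P_i,\bar P_i$, consider the load-shedding problem $$\min_P\ J(P)=\|W\circ(P-P^0)\|^2\quad\text{s.t.}\quad (P^m_{ij})^2\le\sigma_{ij}^2\ \ ((i,j)\in\mathcal E),\qquad \underline P_i\le P_i\le\bar P_i\ \ (1\le i\le n_b),$$ whose feasible region is assumed to be nonempty, and its Lagrangian $$L(P,\lambda,\tau)=J(P)+\sum_{(i,j)\in\mathcal E}\lambda_{ij}\left[(P^m_{ij})^2-\sigma_{ij}^2\right]+\sum_i\bar\tau_i(P_i-\bar P_i)+\sum_i\underline\tau_i(\underline P_i-P_i),\qquad \tau=(\bar\tau,\underline\tau).$$ The saddle point dynamics is $$\dot P=-\nabla_PL(P,\lambda,\tau),\qquad \dot\lambda_{ij}=[\partial_{\lambda_{ij}}L]^+_{\lambda_{ij}},\qquad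 \dot{\bar\tau}_i=[\partial_{\bar\tau_i}L]^+_{\bar\tau_i},\qquad \dot{\underline\tau}_i=[\partial_{\underline\tau_i}L]^+_{\underline\tau_i},$$ where $[x]^+_y=x$ if $y>0$ and $[x]^+_y=\max\{x,0\}$ if $y=0$. Its state space is $\{(P,\lambda,\tau):\lambda\ge0,\ \tau\ge0\}$, and a solution is a locally absolutely continuous function on $[0,\infty)$ with values in the state space that satisfies the equations for almost every $t$. Proposition. The load-shedding problem has a unique optimal solution $P^*$, and the saddle point dynamics globally asymptotically converges to it. That is: (i) for every initial state with nonnegative multipliers there is a solution on $[0,\infty)$; (ii) every solution $(P(t),\lambda(t),\tau(t))$ converges, as $t\to\infty$, to a saddle point $(P^*,\lambda^*,\tau^*)$ of $L$ (minimum over all $P$, maximum over all nonnegative multipliers), so that in particular $P(t)\to P^*$; (iii) every saddle point of $L$ is Lyapunov stable: for each $\varepsilon>0$ there is $\delta'>0$ such that every solution that starts within $\delta'$ of it stays within $\varepsilon$ of it. -/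

import Mathlib

open Filter Topology MeasureTheory

noncomputable section

/-- Data of the load-shedding problem: a power network with `nb` buses and `n` branches, the
parameters of the cascading model, and the parameters of the optimization problem. -/
structure PowerGrid (nb n : ℕ) where
  /-- the two end buses of each branch -/
  src : Fin n → Fin nb
  tgt : Fin n → Fin nb
  src_ne_tgt : ∀ l, src l ≠ tgt l
  /-- original branch admittances -/
  Y0 : Fin n → ℝ
  /-- initial disturbance of the branch admittances -/
  δ : Fin n → ℝ
  /-- power thresholds in the cascading model -/
  c : Fin nb → Fin nb → ℝ
  /-- tunable parameter of the smoothed outage function -/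
  sharpness : ℝ
  /-- original injected power on each bus -/
  P0 : EuclideanSpace ℝ (Fin nb)
  /-- weights of the buses -/
  W : Fin nb → ℝ
  /-- power thresholds in the optimization problem -/
  σ : Fin nb → Fin nb → ℝ
  /-- lower and upper bounds of the injected power -/
  Plo : Fin nb → ℝ
  Phi : Fin nb → ℝ

/-- The smoothed outage function of a branch with transmission power `x` and threshold `c`;
`s` is the tunable parameter. -/
def outage (s x c : ℝ) : ℝ :=
  if √(c ^ 2 + Real.pi / (2 * s)) ≤ |x| then 0
  else if |x| ≤ √(c ^ 2 - Real.pi / (2 * s)) then 1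
  else (1 - Real.sin (s * (x ^ 2 - c ^ 2))) / 2

/-- The switching operator `[x]⁺_y` (used for `0 ≤ y`). -/
def projPlus (x y : ℝ) : ℝ := if 0 < y then x else max x 0

namespace PowerGrid

variable {nb n : ℕ} (N : PowerGrid nb n)

/-- The set `ℰ` of pairs of buses that are connected by a branch. -/
abbrev Edge : Type :=
  {p : Fin nb × Fin nb //
    ∃ l, (N.src l = p.1 ∧ N.tgt l = p.2) ∨ (N.src l = p.2 ∧ N.tgt l = p.1)}

/-- Branch-bus incidence matrix `A`. -/
def incidence : Matrix (Fin n) (Fin nb) ℝ :=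
  fun l i => if i = N.src l then 1 else if i = N.tgt l then -1 else 0

/-- Nodal admittance matrix `Aᵀ diag(Y) A`. -/
def nodal (Y : Fin n → ℝ) : Matrix (Fin nb) (Fin nb) ℝ :=
  N.incidence.transpose * Matrix.diagonal Y * N.incidence

/-- The graph of the branches in service. -/
def liveGraph (Y : Fin n → ℝ) : SimpleGraph (Fin nb) :=
  SimpleGraph.fromRel fun i j => ∃ l, Y l ≠ 0 ∧ N.src l = i ∧ N.tgt l = j

/-- The reference bus of each connected subnetwork: its bus of smallest index. -/
def IsRef (Y : Fin n → ℝ) (i : Fin nb) : Prop :=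
  ∀ j, (N.liveGraph Y).Reachable i j → i ≤ j

/-- The nodal admittance matrix without the rows and columns of the reference buses. -/
def reducedNodal (Y : Fin n → ℝ) : Matrix {b // ¬ N.IsRef Y b} {b // ¬ N.IsRef Y b} ℝ :=
  fun i j => N.nodal Y i.1 j.1

open Classical in
/-- The inverse `(Aᵀ diag(Y) A)^{-1*}` of the (singular) nodal admittance matrix: in every connected
subnetwork the row and the column of the reference bus are deleted, what remains is inverted, and
the deleted entries are filled with zeros. As the nodal matrix has no entries between different
subnetworks, all the subnetworks can be inverted at once. -/
def starInv (Y : Fin n → ℝ) : Matrix (Fin nb) (Fin nb) ℝ :=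
  fun i j =>
    if h : ¬ N.IsRef Y i ∧ ¬ N.IsRef Y j then (N.reducedNodal Y)⁻¹ ⟨i, h.1⟩ ⟨j, h.2⟩ else 0

/-- Transmission power between Buses `i` and `j` for branch admittances `Y` and injected power `P`:
`eᵢᵀ Aᵀ diag(Y) A eⱼ (eᵢ - eⱼ)ᵀ (Aᵀ diag(Y) A)^{-1*} P`. -/
def flow (Y : Fin n → ℝ) (P : EuclideanSpace ℝ (Fin nb)) (i j : Fin nb) : ℝ :=
  N.nodal Y i j * ((N.starInv Y).mulVec P.ofLp i - (N.starInv Y).mulVec P.ofLp j)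

/-- Branch admittances `Y_p^k` at the `k`-th cascading step. Before remedial measures are taken the
injected power is the original one. -/
def admittance : ℕ → Fin n → ℝ
  | 0 => N.Y0
  | 1 => N.Y0 + N.δ
  | k + 2 => fun l =>
      outage N.sharpness (N.flow (admittance (k + 1)) N.P0 (N.src l) (N.tgt l))
        (N.c (N.src l) (N.tgt l)) * admittance (k + 1) l

/-- Transmission power `P^m_{ij}` at the `m`-th cascading step, with injected power `P`. -/
def flowAt (m : ℕ) (P : EuclideanSpace ℝ (Fin nb)) (i j : Fin nb) : ℝ :=
  N.flow (N.admittance m) P i j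

/-- Cost `J(P, W) = ‖W ∘ (P - P⁰)‖²`. -/
def cost (P : EuclideanSpace ℝ (Fin nb)) : ℝ :=
  ‖WithLp.toLp 2 (fun i => N.W i * (P i - N.P0 i))‖ ^ 2

/-- Feasible region of the load-shedding problem at the `m`-th cascading step. -/
def feasible (m : ℕ) : Set (EuclideanSpace ℝ (Fin nb)) :=
  {P | (∀ e : N.Edge, N.flowAt m P e.1.1 e.1.2 ^ 2 ≤ N.σ e.1.1 e.1.2 ^ 2) ∧
    ∀ i, N.Plo i ≤ P i ∧ P i ≤ N.Phi i}

/-- `P` is an optimal solution to the load-shedding problem. -/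
def IsOptimal (m : ℕ) (P : EuclideanSpace ℝ (Fin nb)) : Prop :=
  P ∈ N.feasible m ∧ IsMinOn N.cost (N.feasible m) P

/-- Lagrangian function; `tu` and `tl` are the multipliers of the upper and of the lower bounds. -/
def lagrangian (m : ℕ) (P : EuclideanSpace ℝ (Fin nb)) (lam : EuclideanSpace ℝ N.Edge)
    (tu tl : EuclideanSpace ℝ (Fin nb)) : ℝ :=
  N.cost P + ∑ e : N.Edge, lam e * (N.flowAt m P e.1.1 e.1.2 ^ 2 - N.σ e.1.1 e.1.2 ^ 2)
    + ∑ i, tu i * (P i - N.Phi i) + ∑ i, tl i * (N.Plo i - P i)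

/-- States `(P, λ, τ̄, τ̲)` of the saddle point dynamics. -/
abbrev State : Type :=
  EuclideanSpace ℝ (Fin nb) × EuclideanSpace ℝ N.Edge ×
    EuclideanSpace ℝ (Fin nb) × EuclideanSpace ℝ (Fin nb)

/-- All the multipliers of the state are nonnegative. -/
def MultNonneg (z : N.State) : Prop :=
  (∀ e, 0 ≤ z.2.1 e) ∧ (∀ i, 0 ≤ z.2.2.1 i) ∧ ∀ i, 0 ≤ z.2.2.2 i

/-- `z` is a saddle point of the Lagrangian function, which is minimized over all `P` and maximized
over all nonnegative multipliers. -/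
def IsSaddlePoint (m : ℕ) (z : N.State) : Prop :=
  N.MultNonneg z ∧
    ∀ w : N.State, N.MultNonneg w →
      N.lagrangian m z.1 w.2.1 w.2.2.1 w.2.2.2 ≤ N.lagrangian m z.1 z.2.1 z.2.2.1 z.2.2.2 ∧
      N.lagrangian m z.1 z.2.1 z.2.2.1 z.2.2.2 ≤ N.lagrangian m w.1 z.2.1 z.2.2.1 z.2.2.2

/-- Right-hand side of the saddle point dynamics: gradient descent in `P`, projected gradient ascent
in the multipliers. -/
def saddleField (m : ℕ) (z : N.State) : N.State :=
  (-gradient (fun P => N.lagrangian m P z.2.1 z.2.2.1 z.2.2.2) z.1,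
    WithLp.toLp 2 (fun e =>
      projPlus (gradient (fun lam => N.lagrangian m z.1 lam z.2.2.1 z.2.2.2) z.2.1 e) (z.2.1 e)),
    WithLp.toLp 2 (fun i =>
      projPlus (gradient (fun tu => N.lagrangian m z.1 z.2.1 tu z.2.2.2) z.2.2.1 i) (z.2.2.1 i)),
    WithLp.toLp 2 (fun i =>
      projPlus (gradient (fun tl => N.lagrangian m z.1 z.2.1 z.2.2.1 tl) z.2.2.2 i) (z.2.2.2 i)))

/-- `z` is a solution on `[0, ∞)` of the saddle point dynamics, in the sense of Carathéodory (the
right-hand side is discontinuous where a multiplier vanishes). The multipliers stay in the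
nonnegative orthant, where the right-hand side is defined. -/
structure IsTrajectory (m : ℕ) (z : ℝ → N.State) : Prop where
  absCont : ∀ T, 0 < T → AbsolutelyContinuousOnInterval z 0 T
  nonneg : ∀ t, 0 ≤ t → N.MultNonneg (z t)
  ode : ∀ᵐ t : ℝ, 0 < t → HasDerivAt z (N.saddleField m (z t)) t

end PowerGrid

end

/-! At a fixed cascading step the admittances are constants, so every flow is a linear form in `P`.
Load shedding becomes the minimization of a positive definite diagonal quadratic under constraints
that are affine or of the form `(a ⬝ᵥ x)² ≤ σ²` with `σ > 0`; nothing else about the network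
matters.

A minimizer exists by coercivity. Multipliers exist without Slater's condition: where a constraint
`(a ⬝ᵥ x)² ≤ σ²` is active, `a ⬝ᵥ x ≠ 0`, so directions with vanishing first derivative have no
second-order term either. Linearized feasible directions are thus feasible, and Farkas' lemma
applies. By convexity, saddle points are exactly the Karush-Kuhn-Tucker pairs, and strong convexity
makes the primal part unique.

The squared distance to any such pair is nonincreasing along the dynamics
(`QuadProgram.IsKKT.dissipation`), which gives stability and boundedness. Its rate of decrease is at
least twice a nonnegative `gap`, which is therefore integrable. Barbalat's lemma gives `gap → 0`,
hence `P → P*`; applied to `P` itself it gives `∇_P L → 0`. A limit point of the multipliers then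
satisfies the Karush-Kuhn-Tucker conditions, and monotonicity of the distance to that very point
upgrades subsequential convergence to convergence.

Existence has to deal with a discontinuous right-hand side. Projection at zero is Skorokhod
reflection, which is Lipschitz as a map on paths, so a contraction argument solves the problem for
bounded Lipschitz fields. The actual field is cut off by a bump function; this only slows the motion
down, so the distance estimate survives and confines the solution to the region where the cutoff
equals one. -/

noncomputable section

/-! ### Farkas' lemma -/

/-- **Farkas' lemma** for finitely many linear functionals. -/
theorem exists_nonneg_sum_eq_of_forall_nonpos {V ι : Type*} [AddCommGroup V] [Module ℝ V]
    (s : Finset ι) (f : ι → V →ₗ[ℝ] ℝ) (g : V →ₗ[ℝ] ℝ)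
    (h : ∀ v, (∀ i ∈ s, f i v ≤ 0) → g v ≤ 0) :
    ∃ c : ι → ℝ, (∀ i, 0 ≤ c i) ∧ g = ∑ i ∈ s, c i • f i := by
  classical
  induction s using Finset.induction_on generalizing f g with
  | empty =>
    refine ⟨0, fun _ => le_rfl, ?_⟩
    ext v
    have h1 := h v (by simp)
    have h2 := h (-v) (by simp)
    simp only [map_neg] at h2
    simp only [Finset.sum_empty, LinearMap.zero_apply]
    linarith
  | insert a s ha ih =>
    by_cases hs : ∀ v, (∀ i ∈ s, f i v ≤ 0) → g v ≤ 0
    · obtain ⟨c, hc, hg⟩ := ih f g hs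
      refine ⟨Function.update c a 0, fun i => ?_, ?_⟩
      · by_cases hi : i = a
        · subst hi; simp
        · simpa [hi] using hc i
      · rw [Finset.sum_insert ha, hg]
        simp only [Function.update_self, zero_smul, zero_add]
        refine Finset.sum_congr rfl fun i hi => ?_
        rw [Function.update_of_ne (ne_of_mem_of_not_mem hi ha)]
    · push Not at hs
      obtain ⟨v, hv, hgv⟩ := hs
      have hav : 0 < f a v := by
        by_contra hcon
        exact absurd (h v (by
          intro i hi
          rcases Finset.mem_insert.1 hi with rfl | hi
          · linarith
          · exact hv i hi)) (by linarith)
      -- The map `x ↦ x - (f a x / f a v) • v` projects onto the kernel of `f a` along `v`.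
      -- Precomposing all functionals with it removes the constraint `a`.
      obtain ⟨c, hc, hg⟩ := ih (fun i => f i - (f i v / f a v) • f a) (g - (g v / f a v) • f a) (by
        intro x hx
        have := h (x - (f a x / f a v) • v) (by
          intro i hi
          rcases Finset.mem_insert.1 hi with rfl | hi
          · simp [div_mul_cancel₀ _ hav.ne']
          · have := hx i hi
            simp only [LinearMap.sub_apply, LinearMap.smul_apply, smul_eq_mul, map_sub,
              map_smul] at this ⊢
            convert! this using 2
            ring)
        simp only [LinearMap.sub_apply, LinearMap.smul_apply, smul_eq_mul, map_sub,
              map_smul] at this ⊢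
        convert! this using 2
        ring)
      refine ⟨Function.update c a ((g v - ∑ i ∈ s, c i * f i v) / f a v), fun i => ?_, ?_⟩
      · by_cases hi : i = a
        · subst hi
          have : ∑ j ∈ s, c j * f j v ≤ 0 :=
            Finset.sum_nonpos fun j hj => mul_nonpos_of_nonneg_of_nonpos (hc j) (hv j hj)
          simp only [Function.update_self]
          exact div_nonneg (by linarith) hav.le
        · simpa [hi] using hc i
      · rw [Finset.sum_insert ha]
        simp only [Function.update_self]
        have hcongr : ∑ i ∈ s, Function.update c a
            ((g v - ∑ i ∈ s, c i * f i v) / f a v) i • f i = ∑ i ∈ s, c i • f i :=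
          Finset.sum_congr rfl fun i hi => by
            rw [Function.update_of_ne (ne_of_mem_of_not_mem hi ha)]
        rw [hcongr]
        ext x
        have hx := LinearMap.congr_fun hg x
        simp only [LinearMap.sub_apply, LinearMap.smul_apply, smul_eq_mul, LinearMap.add_apply,
          LinearMap.coe_sum, Finset.sum_apply, mul_sub, Finset.sum_sub_distrib] at hx ⊢
        have e : ∑ i ∈ s, c i * (f i v / f a v * f a x)
            = (∑ i ∈ s, c i * f i v) / f a v * f a x := by
          rw [Finset.sum_div, Finset.sum_mul]
          exact Finset.sum_congr rfl fun i _ => by ring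
        rw [e] at hx
        rw [sub_div, sub_mul]
        linarith

/-! ### Absolutely continuous functions and Barbalat's lemma -/

/-- Composition with a Lipschitz map preserves absolute continuity. -/
theorem LipschitzWith.comp_absolutelyContinuousOnInterval {X Y : Type*} [PseudoMetricSpace X]
    [PseudoMetricSpace Y] {K : NNReal} {g : X → Y} (hg : LipschitzWith K g) {f : ℝ → X} {a b : ℝ}
    (hf : AbsolutelyContinuousOnInterval f a b) :
    AbsolutelyContinuousOnInterval (fun t => g (f t)) a b := by
  have h : Tendsto (fun E : ℕ × (ℕ → ℝ × ℝ) =>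
      (K : ℝ) * ∑ i ∈ Finset.range E.1, dist (f (E.2 i).1) (f (E.2 i).2))
      (AbsolutelyContinuousOnInterval.totalLengthFilter ⊓
        𝓟 (AbsolutelyContinuousOnInterval.disjWithin a b)) (𝓝 0) := by
    simpa using Tendsto.const_mul (K : ℝ) hf
  refine squeeze_zero (fun E => Finset.sum_nonneg fun i _ => dist_nonneg) (fun E => ?_) h
  rw [Finset.mul_sum]
  exact Finset.sum_le_sum fun i _ => hg.dist_le_mul _ _

theorem absolutelyContinuousOnInterval_finset_sum {ι : Type*} (s : Finset ι) {f : ι → ℝ → ℝ}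
    {a b : ℝ} (hf : ∀ i ∈ s, AbsolutelyContinuousOnInterval (f i) a b) :
    AbsolutelyContinuousOnInterval (fun t => ∑ i ∈ s, f i t) a b := by
  classical
  induction s using Finset.induction_on with
  | empty =>
    simp only [Finset.sum_empty]
    exact (LipschitzWith.const (0 : ℝ)).lipschitzOnWith.absolutelyContinuousOnInterval
  | insert i s hi ih =>
    simp only [Finset.sum_insert hi]
    exact (hf i (Finset.mem_insert_self i s)).add
      (ih fun j hj => hf j (Finset.mem_insert_of_mem hj))

/-- A function that is absolutely continuous on `[0, T]` for all `T` satisfies the fundamental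
theorem of calculus on `[s, t]`, the derivative being prescribed almost everywhere. -/
theorem integral_eq_sub_of_ae_hasDerivAt {f f' : ℝ → ℝ}
    (hf : ∀ T, 0 < T → AbsolutelyContinuousOnInterval f 0 T)
    (h : ∀ᵐ t, 0 < t → HasDerivAt f (f' t) t) {s t : ℝ} (hs : 0 ≤ s) (hst : s ≤ t) :
    IntervalIntegrable f' volume s t ∧ ∫ r in s..t, f' r = f t - f s := by
  have hac : AbsolutelyContinuousOnInterval f s t := by
    refine (hf (t + 1) (by linarith)).mono ?_
    rw [Set.uIcc_of_le hst, Set.uIcc_of_le (by linarith)]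
    exact Set.Icc_subset_Icc hs (by linarith)
  have hae : ∀ᵐ r, r ∈ Set.uIoc s t → deriv f r = f' r := by
    filter_upwards [h] with r hr hmem
    rw [Set.uIoc_of_le hst] at hmem
    exact (hr (by linarith [hmem.1])).deriv
  refine ⟨?_, ?_⟩
  · refine hac.intervalIntegrable_deriv.congr_ae ?_
    exact (ae_restrict_iff' measurableSet_uIoc).2 hae
  · rw [← hac.integral_deriv_eq_sub]
    exact (intervalIntegral.integral_congr_ae hae).symm

/-- **Barbalat's lemma**: if a function converges and its derivative is uniformly continuous, then
the derivative tends to zero. -/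
theorem tendsto_zero_of_tendsto_of_integral_eq_sub {f g : ℝ → ℝ} {l : ℝ}
    (hf : Tendsto f atTop (𝓝 l)) (hg : UniformContinuousOn g (Set.Ici 0))
    (h : ∀ s t, 0 ≤ s → s ≤ t → ∫ r in s..t, g r = f t - f s) :
    Tendsto g atTop (𝓝 0) := by
  rw [Metric.tendsto_nhds]
  intro ε hε
  obtain ⟨η, hη, hgη⟩ := Metric.uniformContinuousOn_iff.1 hg (ε / 2) (by linarith)
  -- On `[t, t + r]` the integrand stays within `ε / 2` of `g t`, so `r * g t` differs from the
  -- increment of `f` by at most `r * (ε / 2)`, and that increment tends to zero.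
  set r := η / 2 with hr
  have hr0 : 0 < r := by positivity
  have hdiff : Tendsto (fun t => f (t + r) - f t) atTop (𝓝 0) := by
    simpa using (hf.comp (tendsto_atTop_add_const_right _ r tendsto_id)).sub hf
  filter_upwards [Metric.tendsto_nhds.1 hdiff (r * (ε / 2)) (by positivity), eventually_ge_atTop 0]
    with t ht ht0
  have hinteg : IntervalIntegrable g volume t (t + r) := by
    refine (hg.continuousOn.mono ?_).intervalIntegrable
    rw [Set.uIcc_of_le (by linarith)]
    exact fun x hx => ht0.trans hx.1
  have e : ∫ x in t..(t + r), (g x - g t) = f (t + r) - f t - r * g t := by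
    rw [intervalIntegral.integral_sub hinteg (by simp), h t (t + r) ht0 (by linarith)]
    simp
  have hle : ‖∫ x in t..(t + r), (g x - g t)‖ ≤ ε / 2 * |t + r - t| := by
    refine intervalIntegral.norm_integral_le_of_norm_le_const fun x hx => ?_
    rw [Set.uIoc_of_le (by linarith)] at hx
    have := hgη x (ht0.trans hx.1.le) t ht0 (by
      rw [Real.dist_eq, abs_of_nonneg (by linarith [hx.1])]
      linarith [hx.2])
    rw [Real.dist_eq] at this
    exact this.le
  rw [e, Real.norm_eq_abs, add_sub_cancel_left, abs_of_pos hr0] at hle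
  rw [Real.dist_eq, sub_zero] at ht ⊢
  have h1 : |r * g t| < r * ε := by
    calc |r * g t| = |(f (t + r) - f t) - (f (t + r) - f t - r * g t)| := by congr 1; ring
      _ ≤ |f (t + r) - f t| + |f (t + r) - f t - r * g t| := abs_sub _ _
      _ < r * ε := by linarith
  rw [abs_mul, abs_of_pos hr0] at h1
  exact lt_of_mul_lt_mul_left h1 hr0.le

/-! ### The Skorokhod regulator on the half line -/

/-- The regulator of the Skorokhod problem on the half line: the least nondecreasing function that
keeps `X + regulator X` nonnegative on `[0, ∞)`. -/
def regulator (X : ℝ → ℝ) (t : ℝ) : ℝ :=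
  sSup ((fun r => max 0 (-X (r * max t 0))) '' Set.Icc 0 1)

section Regulator

variable {X Y : ℝ → ℝ} {s t : ℝ}

/-- The definition rescales `[0, t]` to the fixed interval `[0, 1]` so that continuity in `t` is
that of a supremum over a fixed compact set. This is the usual running maximum, and it is attained.
-/
theorem isGreatest_regulator (hX : Continuous X) (ht : 0 ≤ t) :
    IsGreatest ((fun s => max 0 (-X s)) '' Set.Icc 0 t) (regulator X t) := by
  have e : (fun r => max 0 (-X (r * max t 0))) '' Set.Icc 0 1
      = (fun s => max 0 (-X s)) '' Set.Icc 0 t := by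
    have : Set.Icc 0 t = (fun r => r * max t 0) '' Set.Icc 0 1 := by
      rw [max_eq_left ht]
      ext r
      constructor
      · rintro ⟨h0, h1⟩
        rcases ht.eq_or_lt with rfl | hpos
        · exact ⟨0, by simp, by simp; linarith⟩
        · exact ⟨r / t, ⟨by positivity, (div_le_one hpos).2 h1⟩, by field_simp⟩
      · rintro ⟨q, ⟨h0, h1⟩, rfl⟩
        exact ⟨by positivity, by simpa using mul_le_mul_of_nonneg_right h1 ht⟩
    rw [this, Set.image_image]
  rw [regulator, e]
  exact (isCompact_Icc.image (by fun_prop)).isGreatest_sSup ((Set.nonempty_Icc.2 ht).image _)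

theorem continuous_regulator (hX : Continuous X) : Continuous (regulator X) := by
  unfold regulator
  exact isCompact_Icc.continuous_sSup (f := fun t r => max 0 (-X (r * max t 0)))
    (by simp only [Function.HasUncurry.uncurry, id]; fun_prop)

theorem max_le_regulator (hX : Continuous X) (hs : 0 ≤ s) (hst : s ≤ t) :
    max 0 (-X s) ≤ regulator X t :=
  (isGreatest_regulator hX (hs.trans hst)).2 ⟨s, ⟨hs, hst⟩, rfl⟩

theorem regulator_le (hX : Continuous X) (ht : 0 ≤ t) {c : ℝ}
    (h : ∀ s ∈ Set.Icc 0 t, max 0 (-X s) ≤ c) : regulator X t ≤ c := by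
  obtain ⟨s, hs, e⟩ := (isGreatest_regulator hX ht).1
  rw [← e]
  exact h s hs

theorem regulator_max (X : ℝ → ℝ) (t : ℝ) : regulator X (max t 0) = regulator X t := by
  simp [regulator]

theorem monotone_regulator (hX : Continuous X) : Monotone (regulator X) := by
  intro s t hst
  rw [← regulator_max X s, ← regulator_max X t]
  exact regulator_le hX (le_max_right _ _) fun r hr =>
    max_le_regulator hX hr.1 (hr.2.trans (max_le_max_right 0 hst))

theorem regulator_le_regulator_add (hX : Continuous X) (hY : Continuous Y) (ht : 0 ≤ t) {c : ℝ}
    (h : ∀ s ∈ Set.Icc 0 t, |X s - Y s| ≤ c) : regulator X t ≤ regulator Y t + c := by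
  have hc : 0 ≤ c := (abs_nonneg _).trans (h 0 ⟨le_rfl, ht⟩)
  refine regulator_le hX ht fun s hs => ?_
  have h1 := max_le_regulator hY hs.1 hs.2
  have h2 := abs_le.1 (h s hs)
  exact max_le (by linarith [le_max_left 0 (-Y s)]) (by linarith [le_max_right 0 (-Y s), h2.1])

theorem abs_regulator_sub_le (hX : Continuous X) (hY : Continuous Y) (ht : 0 ≤ t) {c : ℝ}
    (h : ∀ s ∈ Set.Icc 0 t, |X s - Y s| ≤ c) : |regulator X t - regulator Y t| ≤ c := by
  rw [abs_le]
  have h1 := regulator_le_regulator_add hX hY ht h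
  have h2 := regulator_le_regulator_add hY hX ht (c := c) (fun s hs => abs_sub_comm (X s) _ ▸ h s hs)
  constructor <;> linarith

/-- After time `s` the running maximum can only rise as far as `X` falls below `X s`, so a Lipschitz
bound on `X` passes to the regulator. -/
theorem regulator_sub_le (hX : Continuous X) {M : ℝ} (hM : 0 ≤ M)
    (h : ∀ s t, 0 ≤ s → s ≤ t → |X t - X s| ≤ M * (t - s)) (hs : 0 ≤ s) (hst : s ≤ t) :
    |regulator X t - regulator X s| ≤ M * (t - s) := by
  rw [abs_of_nonneg (sub_nonneg.2 (monotone_regulator hX hst)), sub_le_iff_le_add]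
  refine regulator_le hX (hs.trans hst) fun r hr => ?_
  rcases le_total r s with hrs | hsr
  · have := max_le_regulator hX hr.1 hrs
    nlinarith
  · have h1 := max_le_regulator hX hs le_rfl
    have h2 := abs_le.1 (h s r hs hsr)
    have h3 : M * (r - s) ≤ M * (t - s) := mul_le_mul_of_nonneg_left (by linarith [hr.2]) hM
    refine max_le ?_ ?_
    · have := mul_nonneg hM (sub_nonneg.2 hst)
      linarith [le_max_left 0 (-X s)]
    · linarith [le_max_right 0 (-X s), h2.1]

/-- While the reflected path is positive, `-X` lies strictly below its running maximum near `t`: no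
new maximum is set, so there is no push. -/
theorem regulator_eventuallyEq_const (hX : Continuous X) (ht : 0 < t)
    (hpos : 0 < X t + regulator X t) : regulator X =ᶠ[𝓝 t] fun _ => regulator X t := by
  have hev : ∀ᶠ r in 𝓝 t, -X r < regulator X t :=
    hX.neg.continuousAt.eventually_lt continuousAt_const (show -X t < regulator X t by linarith)
  obtain ⟨η, hη, hball⟩ := Metric.eventually_nhds_iff.1 hev
  have hreg0 : 0 ≤ regulator X t := (le_max_left _ _).trans (max_le_regulator hX ht.le le_rfl)
  have hupper : ∀ r, t ≤ r → r < t + η → regulator X r = regulator X t := by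
    intro r htr hr
    refine le_antisymm (regulator_le hX (ht.le.trans htr) fun q hq => ?_)
      (monotone_regulator hX htr)
    rcases le_total q t with hqt | htq
    · exact max_le_regulator hX hq.1 hqt
    · refine max_le hreg0 (hball ?_).le
      rw [Real.dist_eq, abs_of_nonneg (by linarith)]
      linarith [hq.2]
  obtain ⟨q, hq, e⟩ := (isGreatest_regulator hX ht.le).1
  obtain ⟨q', hq'0, hq't, hq'⟩ : ∃ q', 0 ≤ q' ∧ q' < t ∧
      regulator X t ≤ regulator X q' := by
    simp only at e
    rcases hq.2.lt_or_eq with hlt | rfl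
    · exact ⟨q, hq.1, hlt, by rw [← e]; exact max_le_regulator hX hq.1 le_rfl⟩
    -- If the maximum is attained at `t` itself, it cannot be `-X t`, which is strictly smaller; so
    -- it is `0`, already attained at time `0`.
    · have h0 : regulator X q = 0 := by
        rcases max_choice 0 (-X q) with h | h
        · rw [← e, h]
        · rw [h] at e; linarith
      refine ⟨0, le_rfl, ht, ?_⟩
      rw [h0]
      exact (le_max_left _ _).trans (max_le_regulator hX le_rfl le_rfl)
  filter_upwards [Ioo_mem_nhds hq't (show t < t + η by linarith)] with r hr
  rcases le_total t r with htr | hrt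
  · exact hupper r htr hr.2
  · exact le_antisymm (monotone_regulator hX hrt) (hq'.trans (monotone_regulator hX hr.1.le))

theorem add_regulator_nonneg (hX : Continuous X) (ht : 0 ≤ t) : 0 ≤ X t + regulator X t := by
  linarith [le_max_right 0 (-X t), max_le_regulator hX ht le_rfl]

theorem regulator_zero (hX : Continuous X) (h0 : 0 ≤ X 0) : regulator X 0 = 0 := by
  refine le_antisymm (regulator_le hX le_rfl fun s hs => ?_)
    ((le_max_left _ _).trans (max_le_regulator hX le_rfl le_rfl))
  obtain rfl : s = 0 := le_antisymm hs.2 hs.1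
  simpa using h0

/-- The reflected function moves with the speed of `X`, switched off where it would become
negative. -/
theorem hasDerivAt_add_regulator (hX : Continuous X) (ht : 0 < t) {v : ℝ} (hv : HasDerivAt X v t)
    (hreg : DifferentiableAt ℝ (regulator X) t) :
    HasDerivAt (fun r => X r + regulator X r) (projPlus v (X t + regulator X t)) t := by
  rcases (add_regulator_nonneg hX ht.le).eq_or_lt with h0 | hpos
  -- At a zero the nonnegative reflected path has a local minimum, so its derivative vanishes. The
  -- regulator has nonnegative derivative, hence `v ≤ 0` and the projected speed is zero too.
  · have hmin : IsLocalMin (fun r => X r + regulator X r) t := by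
      filter_upwards [lt_mem_nhds ht] with r hr
      rw [← h0]
      exact add_regulator_nonneg hX hr.le
    have hd := hv.add hreg.hasDerivAt
    have hzero : v + deriv (regulator X) t = 0 := hmin.hasDerivAt_eq_zero hd
    have hnn : 0 ≤ deriv (regulator X) t := (monotone_regulator hX).deriv_nonneg
    have : projPlus v (X t + regulator X t) = v + deriv (regulator X) t := by
      rw [← h0, projPlus, if_neg (lt_irrefl _), hzero, max_eq_right (by linarith)]
    rw [this]
    exact hd
  · rw [projPlus, if_pos hpos]
    have := hv.add ((hasDerivAt_const t (regulator X t)).congr_of_eventuallyEq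
      (regulator_eventuallyEq_const hX ht hpos))
    rwa [add_zero] at this

end Regulator

/-! ### Reflected equations with a bounded Lipschitz field -/

section Reflected

variable {ι : Type*}

/-- The motion with initial position `u₀` and velocity `v`. -/
def drift (u₀ : ι → ℝ) (v : ℝ → ι → ℝ) (i : ι) (t : ℝ) : ℝ := u₀ i + ∫ s in (0)..t, v s i

/-- The motion with initial position `u₀` and velocity `v`, where the coordinates in `S` are
reflected at zero. -/
def reflected (S : ι → Prop) [DecidablePred S] (u₀ : ι → ℝ) (v : ℝ → ι → ℝ) (t : ℝ) (i : ι) : ℝ :=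
  drift u₀ v i t + if S i then regulator (drift u₀ v i) t else 0

variable {S : ι → Prop} [DecidablePred S] {u₀ : ι → ℝ} {v v' : ℝ → ι → ℝ}

theorem hasDerivAt_drift (hv : Continuous v) (i : ι) (t : ℝ) :
    HasDerivAt (drift u₀ v i) (v t i) t := by
  have hi : Continuous fun s => v s i := (continuous_apply i).comp hv
  exact (hi.integral_hasStrictDerivAt 0 t).hasDerivAt.const_add _

theorem continuous_drift (hv : Continuous v) (i : ι) : Continuous (drift u₀ v i) :=
  continuous_iff_continuousAt.2 fun t => (hasDerivAt_drift hv i t).continuousAt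

theorem continuous_reflected (hv : Continuous v) : Continuous (reflected S u₀ v) := by
  refine continuous_pi fun i => ?_
  unfold reflected
  refine (continuous_drift hv i).add ?_
  split_ifs
  · exact continuous_regulator (continuous_drift hv i)
  · exact continuous_const

/-- Reflection is Lipschitz with constant 2 in the uniform norm on `[0, t]`: one part from the
drift, one from its regulator. -/
theorem abs_reflected_sub_le (hv : Continuous v) (hv' : Continuous v') {t c : ℝ} (ht : 0 ≤ t)
    (h : ∀ i, ∀ s ∈ Set.Icc 0 t, |drift u₀ v i s - drift u₀ v' i s| ≤ c) (i : ι) :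
    |reflected S u₀ v t i - reflected S u₀ v' t i| ≤ 2 * c := by
  have h1 := h i t ⟨ht, le_rfl⟩
  have hc : 0 ≤ c := (abs_nonneg _).trans h1
  have h2 := abs_regulator_sub_le (continuous_drift hv i) (continuous_drift hv' i) ht (h i)
  unfold reflected
  split_ifs
  · rw [add_sub_add_comm]
    exact (abs_add_le _ _).trans (by linarith)
  · simp only [add_zero]
    linarith

theorem abs_drift_sub_le_of_exp [Fintype ι] (hv : Continuous v) (hv' : Continuous v') {α D : ℝ}
    (hα : 0 < α) (hD : 0 ≤ D) (h : ∀ s, 0 ≤ s → ‖v s - v' s‖ ≤ Real.exp (α * s) * D)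
    (i : ι) {s t : ℝ} (hs : 0 ≤ s) (hst : s ≤ t) :
    |drift u₀ v i s - drift u₀ v' i s| ≤ Real.exp (α * t) * D / α := by
  have hi : Continuous fun s => v s i := (continuous_apply i).comp hv
  have hi' : Continuous fun s => v' s i := (continuous_apply i).comp hv'
  have e : drift u₀ v i s - drift u₀ v' i s = ∫ r in (0)..s, (v r i - v' r i) := by
    rw [intervalIntegral.integral_sub (hi.intervalIntegrable _ _) (hi'.intervalIntegrable _ _)]
    simp [drift]
  have hexp : ∫ r in (0)..s, Real.exp (α * r) * D
      = Real.exp (α * s) * D / α - Real.exp (α * 0) * D / α := by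
    refine intervalIntegral.integral_eq_sub_of_hasDerivAt
      (f := fun r => Real.exp (α * r) * D / α) (fun r _ => ?_)
      (Continuous.intervalIntegrable (by fun_prop) _ _)
    have := ((((hasDerivAt_id r).const_mul α).exp).mul_const D).div_const α
    convert! this using 1
    simp only [id]
    field_simp
  rw [e, ← Real.norm_eq_abs]
  calc ‖∫ r in (0)..s, (v r i - v' r i)‖ ≤ ∫ r in (0)..s, Real.exp (α * r) * D := by
        refine intervalIntegral.norm_integral_le_of_norm_le hs (ae_of_all _ fun r hr => ?_)
          (Continuous.intervalIntegrable (by fun_prop) _ _)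
        exact (norm_le_pi_norm (v r - v' r) i).trans (h r hr.1.le)
    _ ≤ Real.exp (α * s) * D / α := by
        rw [hexp]
        have : 0 ≤ Real.exp (α * 0) * D / α := by positivity
        linarith
    _ ≤ Real.exp (α * t) * D / α := by gcongr

/-- Existence of a velocity field `v` with `v = F ∘ reflected v` on `[0, ∞)`. -/
theorem exists_velocity_eq [Fintype ι] (S : ι → Prop) [DecidablePred S]
    {F : (ι → ℝ) → ι → ℝ} {L : NNReal} (hF : LipschitzWith L F) {M : ℝ} (hM : ∀ u, ‖F u‖ ≤ M)
    (u₀ : ι → ℝ) :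
    ∃ v : ℝ → ι → ℝ, Continuous v ∧ ∀ t, 0 ≤ t → v t = F (reflected S u₀ v t) := by
  -- The fixed point is sought for `w s = exp (-α s) • v s`, in the sup norm. Integration in time
  -- gains `1 / α` and reflection costs 2, so the contraction factor is `2 L / α ≤ 1 / 2`; the
  -- summand 1 keeps `α` positive when `L = 0`.
  set α : ℝ := 4 * L + 1 with hα
  have hα0 : 0 < α := by positivity
  let vel : BoundedContinuousFunction ℝ (ι → ℝ) → ℝ → ι → ℝ := fun w s => Real.exp (α * s) • w s
  have hvel : ∀ w, Continuous (vel w) := fun w => by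
    have := w.continuous
    fun_prop
  have hbound : ∀ w t, ‖Real.exp (-(α * max t 0)) • F (reflected S u₀ (vel w) (max t 0))‖ ≤ M := by
    intro w t
    rw [norm_smul, Real.norm_eq_abs, Real.abs_exp]
    have h1 : Real.exp (-(α * max t 0)) ≤ 1 := Real.exp_le_one_iff.2 (by
      have := mul_nonneg hα0.le (le_max_right t 0)
      linarith)
    calc _ ≤ 1 * M := mul_le_mul h1 (hM _) (norm_nonneg _) zero_le_one
      _ = M := one_mul M
  have hcont : ∀ w, Continuous fun t =>
      Real.exp (-(α * max t 0)) • F (reflected S u₀ (vel w) (max t 0)) := by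
    intro w
    have h1 : Continuous (reflected S u₀ (vel w)) := continuous_reflected (hvel w)
    have h2 := hF.continuous
    fun_prop
  let Ψ : BoundedContinuousFunction ℝ (ι → ℝ) → BoundedContinuousFunction ℝ (ι → ℝ) := fun w =>
    BoundedContinuousFunction.ofNormedAddCommGroup _ (hcont w) M (hbound w)
  have hΨ : ContractingWith (1 / 2) Ψ := by
    refine ⟨by norm_num, LipschitzWith.of_dist_le_mul fun w w' => ?_⟩
    have hD : 0 ≤ dist w w' := dist_nonneg
    refine (BoundedContinuousFunction.dist_le (by positivity)).2 fun t => ?_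
    simp only [Ψ, BoundedContinuousFunction.coe_ofNormedAddCommGroup]
    set τ := max t 0
    have hτ : 0 ≤ τ := le_max_right _ _
    rw [dist_smul₀, Real.norm_eq_abs, Real.abs_exp]
    have hrefl : dist (reflected S u₀ (vel w) τ) (reflected S u₀ (vel w') τ)
        ≤ 2 * (Real.exp (α * τ) * dist w w' / α) := by
      refine (dist_pi_le_iff (by positivity)).2 fun i => ?_
      refine abs_reflected_sub_le (hvel w) (hvel w') hτ (fun j s hs => ?_) i
      refine abs_drift_sub_le_of_exp (hvel w) (hvel w') hα0 hD (fun r _ => ?_) j hs.1 hs.2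
      simp only [vel]
      rw [← smul_sub, norm_smul, Real.norm_eq_abs, Real.abs_exp, ← dist_eq_norm]
      gcongr
      exact w.dist_coe_le_dist r
    calc Real.exp (-(α * τ)) * dist (F (reflected S u₀ (vel w) τ)) (F (reflected S u₀ (vel w') τ))
        ≤ Real.exp (-(α * τ)) * (L * (2 * (Real.exp (α * τ) * dist w w' / α))) := by
          gcongr
          exact (hF.dist_le_mul _ _).trans (by gcongr)
      _ = (Real.exp (-(α * τ)) * Real.exp (α * τ)) * (2 * L / α) * dist w w' := by ring
      _ = 2 * L / α * dist w w' := by rw [← Real.exp_add]; simp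
      _ ≤ ((1 / 2 : NNReal) : ℝ) * dist w w' := by
          gcongr
          rw [div_le_iff₀ hα0, hα]
          push_cast
          linarith
  have : Nonempty (BoundedContinuousFunction ℝ (ι → ℝ)) := ⟨0⟩
  set w := ContractingWith.fixedPoint Ψ hΨ
  have hw : Ψ w = w := hΨ.fixedPoint_isFixedPt
  refine ⟨vel w, hvel w, fun t ht => ?_⟩
  have h1 : w t = Real.exp (-(α * max t 0)) • F (reflected S u₀ (vel w) (max t 0)) := by
    conv_lhs => rw [← hw]
    rfl
  rw [max_eq_left ht] at h1
  have h2 : vel w t = Real.exp (α * t) • w t := rfl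
  rw [h2, h1, smul_smul, ← Real.exp_add]
  simp

/-- Global existence for an ordinary differential equation with a bounded Lipschitz right-hand side,
where the coordinates in `S` are reflected at zero. -/
theorem exists_reflected_solution [Fintype ι] (S : ι → Prop) [DecidablePred S]
    {F : (ι → ℝ) → ι → ℝ} {L : NNReal} (hF : LipschitzWith L F) {M : ℝ} (hM : ∀ u, ‖F u‖ ≤ M)
    (u₀ : ι → ℝ) (h₀ : ∀ i, S i → 0 ≤ u₀ i) :
    ∃ u : ℝ → ι → ℝ, u 0 = u₀ ∧ (∃ K, LipschitzOnWith K u (Set.Ici 0)) ∧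
      (∀ t, 0 ≤ t → ∀ i, S i → 0 ≤ u t i) ∧
      ∀ᵐ t : ℝ, 0 < t → ∀ i, HasDerivAt (fun r => u r i)
        (if S i then projPlus (F (u t) i) (u t i) else F (u t) i) t := by
  obtain ⟨v, hv, hvF⟩ := exists_velocity_eq S hF hM u₀
  have hM0 : 0 ≤ M := (norm_nonneg _).trans (hM 0)
  have hd0 : ∀ i, drift u₀ v i 0 = u₀ i := fun i => by simp [drift]
  have hdrift : ∀ i s t, 0 ≤ s → s ≤ t → |drift u₀ v i t - drift u₀ v i s| ≤ M * (t - s) := by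
    intro i s t hs hst
    have := (convex_Icc s t).norm_image_sub_le_of_norm_hasDerivWithin_le
      (f := drift u₀ v i) (f' := fun r => v r i) (C := M)
      (fun r _ => (hasDerivAt_drift hv i r).hasDerivWithinAt)
      (fun r hr => by
        rw [hvF r (hs.trans hr.1)]
        exact (norm_le_pi_norm _ i).trans (hM _))
      (Set.left_mem_Icc.2 hst) (Set.right_mem_Icc.2 hst)
    rwa [Real.norm_eq_abs, Real.norm_eq_abs, abs_of_nonneg (sub_nonneg.2 hst)] at this
  refine ⟨reflected S u₀ v, ?_, ⟨(2 * M).toNNReal, ?_⟩, ?_, ?_⟩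
  · funext i
    unfold reflected
    split_ifs with hi
    · rw [regulator_zero (continuous_drift hv i) (by rw [hd0]; exact h₀ i hi), hd0, add_zero]
    · rw [hd0, add_zero]
  · have key : ∀ s t, 0 ≤ s → s ≤ t →
        dist (reflected S u₀ v s) (reflected S u₀ v t) ≤ 2 * M * dist s t := by
      intro s t hs hst
      refine (dist_pi_le_iff (by positivity)).2 fun i => ?_
      have h1 := hdrift i s t hs hst
      have h2 := regulator_sub_le (continuous_drift hv i) hM0 (hdrift i) hs hst
      have h3 : 0 ≤ M * (t - s) := mul_nonneg hM0 (sub_nonneg.2 hst)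
      rw [dist_comm, dist_comm s t, Real.dist_eq, Real.dist_eq, abs_of_nonneg (sub_nonneg.2 hst)]
      unfold reflected
      split_ifs
      · rw [add_sub_add_comm]
        exact (abs_add_le _ _).trans (by linarith)
      · simp only [add_zero]
        linarith
    refine LipschitzOnWith.of_dist_le_mul fun s hs t ht => ?_
    rw [Real.coe_toNNReal _ (by positivity)]
    rcases le_total s t with hst | hts
    · exact key s t hs hst
    · rw [dist_comm, dist_comm s t]
      exact key t s ht hts
  · intro t ht i hi
    simp only [reflected, if_pos hi]
    exact add_regulator_nonneg (continuous_drift hv i) ht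
  -- Monotone functions are differentiable almost everywhere; this is where the solution holds only
  -- in the Carathéodory sense.
  · have hae : ∀ᵐ t : ℝ, ∀ i, DifferentiableAt ℝ (regulator (drift u₀ v i)) t :=
      ae_all_iff.2 fun i => (monotone_regulator (continuous_drift hv i)).ae_differentiableAt
    filter_upwards [hae] with t hdiff ht i
    have hder : HasDerivAt (drift u₀ v i) (F (reflected S u₀ v t) i) t := by
      rw [← hvF t ht.le]
      exact hasDerivAt_drift hv i t
    split_ifs with hi
    · have := hasDerivAt_add_regulator (continuous_drift hv i) ht hder (hdiff i)
      simp only [reflected, if_pos hi] at this ⊢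
      exact this
    · simpa only [reflected, if_neg hi, add_zero] using hder

end Reflected

/-! ### Quadratic programs: minimizers, multipliers and saddle points -/

/-- The convex program of minimizing `∑ w (x - p)²` subject to the constraints
`q (a ⬝ᵥ x)² + b ⬝ᵥ x + d ≤ 0`, each of which is affine or a two-sided bound on a linear form. -/
structure QuadProgram (κ ι : Type*) where
  w : κ → ℝ
  p : κ → ℝ
  a : ι → κ → ℝ
  b : ι → κ → ℝ
  q : ι → ℝ
  d : ι → ℝ
  w_pos : ∀ k, 0 < w k
  q_nonneg : ∀ j, 0 ≤ q j
  affine_or_bound : ∀ j, q j = 0 ∨ (b j = 0 ∧ d j < 0)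

/-- The projection changes `c` only when `y = 0` and `c < 0`; it then raises the speed, and the
factor `y - y'` is nonpositive. -/
theorem projPlus_mul_le {c y y' : ℝ} (hy : 0 ≤ y) (hy' : 0 ≤ y') :
    (y - y') * projPlus c y ≤ (y - y') * c := by
  unfold projPlus
  split_ifs with h
  · exact le_rfl
  · obtain rfl : y = 0 := le_antisymm (not_lt.1 h) hy
    have := mul_le_mul_of_nonneg_left (le_max_left c 0) hy'
    linarith

theorem hasDerivAt_affine_add_sq (l g C : ℝ) :
    HasDerivAt (fun t : ℝ => l + t * g + t ^ 2 * C) g 0 := by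
  have := (((hasDerivAt_id (0 : ℝ)).mul_const g).const_add l).add
    (((hasDerivAt_id (0 : ℝ)).pow 2).mul_const C)
  simpa [Pi.add_def] using this

namespace QuadProgram

open Matrix in
/-- The `j`-th constraint function. -/
def con {κ ι : Type*} [Fintype κ] (Q : QuadProgram κ ι) (j : ι) (x : κ → ℝ) : ℝ :=
  Q.q j * (Q.a j ⬝ᵥ x) ^ 2 + Q.b j ⬝ᵥ x + Q.d j

open Matrix in
/-- Partial derivatives of the `j`-th constraint function. -/
def conGrad {κ ι : Type*} [Fintype κ] (Q : QuadProgram κ ι) (j : ι) (x : κ → ℝ) (k : κ) : ℝ :=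
  2 * Q.q j * (Q.a j ⬝ᵥ x) * Q.a j k + Q.b j k

variable {κ ι : Type*} [Fintype κ] (Q : QuadProgram κ ι)

/-- The objective function. -/
def obj (x : κ → ℝ) : ℝ := ∑ k, Q.w k * (x k - Q.p k) ^ 2

/-- The weighted squared distance of `x` and `x'`. -/
def wdist (x x' : κ → ℝ) : ℝ := ∑ k, Q.w k * (x' k - x k) ^ 2

theorem wdist_nonneg (x x' : κ → ℝ) : 0 ≤ Q.wdist x x' :=
  Finset.sum_nonneg fun k _ => mul_nonneg (Q.w_pos k).le (sq_nonneg _)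

theorem mul_sq_le_wdist (x x' : κ → ℝ) (k : κ) : Q.w k * (x' k - x k) ^ 2 ≤ Q.wdist x x' :=
  Finset.single_le_sum (f := fun k => Q.w k * (x' k - x k) ^ 2)
    (fun k _ => mul_nonneg (Q.w_pos k).le (sq_nonneg _)) (Finset.mem_univ k)

theorem eq_of_wdist_nonpos {x x' : κ → ℝ} (h : Q.wdist x x' ≤ 0) : x' = x := by
  funext k
  have h1 := Q.mul_sq_le_wdist x x' k
  have h2 : (x' k - x k) ^ 2 = 0 :=
    le_antisymm (by have := Q.w_pos k; by_contra! hc; nlinarith [mul_pos this hc]) (sq_nonneg _)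
  have := pow_eq_zero_iff (two_ne_zero) |>.1 h2
  linarith

open Matrix in
theorem con_expand (j : ι) (x x' : κ → ℝ) :
    Q.con j x' = Q.con j x + ∑ k, Q.conGrad j x k * (x' k - x k)
      + Q.q j * (Q.a j ⬝ᵥ (x' - x)) ^ 2 := by
  have e : ∑ k, Q.conGrad j x k * (x' k - x k)
      = 2 * Q.q j * (Q.a j ⬝ᵥ x) * (Q.a j ⬝ᵥ (x' - x)) + Q.b j ⬝ᵥ (x' - x) := by
    simp only [conGrad, add_mul, Finset.sum_add_distrib, dotProduct, Finset.mul_sum, Pi.sub_apply,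
      mul_assoc]
  rw [e]
  simp only [con, dotProduct_sub]
  ring

theorem obj_expand (x x' : κ → ℝ) :
    Q.obj x' = Q.obj x + ∑ k, 2 * Q.w k * (x k - Q.p k) * (x' k - x k) + Q.wdist x x' := by
  simp only [obj, wdist, ← Finset.sum_add_distrib]
  exact Finset.sum_congr rfl fun k _ => by ring

variable {Q} in
theorem continuous_con (j : ι) : Continuous (Q.con j) := by
  unfold con dotProduct
  fun_prop

variable {Q} in
-- This replaces a constraint qualification: every linearized feasible direction at `x` is feasible
-- for small positive steps, with no interior point assumed.
theorem eventually_con_le {x v : κ → ℝ} {j : ι} (hx : Q.con j x ≤ 0)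
    (hv : Q.con j x = 0 → ∑ k, Q.conGrad j x k * v k ≤ 0) :
    ∀ᶠ t in 𝓝[>] (0 : ℝ), Q.con j (x + t • v) ≤ 0 := by
  rcases hx.lt_or_eq with hlt | h0
  · have hc : ContinuousAt (fun t : ℝ => Q.con j (x + t • v)) 0 :=
      ((continuous_con j).comp (by fun_prop : Continuous fun t : ℝ => x + t • v)).continuousAt
    have := hc.eventually_lt (continuousAt_const (y := (0 : ℝ))) (by simpa using hlt)
    exact (this.filter_mono nhdsWithin_le_nhds).mono fun t ht => ht.le
  · have hexp : ∀ t : ℝ, Q.con j (x + t • v) = t * (∑ k, Q.conGrad j x k * v k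
        + t * (Q.q j * (dotProduct (Q.a j) v) ^ 2)) := by
      intro t
      rw [Q.con_expand j x, h0]
      simp only [add_sub_cancel_left, Pi.add_apply, Pi.smul_apply, smul_eq_mul, dotProduct_smul,
        mul_add, Finset.mul_sum, zero_add]
      congr 1
      · exact Finset.sum_congr rfl fun k _ => by ring
      · ring
    rcases (hv h0).lt_or_eq with hneg | hzero
    · have hc : ContinuousAt (fun t : ℝ => ∑ k, Q.conGrad j x k * v k
          + t * (Q.q j * (dotProduct (Q.a j) v) ^ 2)) 0 := by fun_prop
      have := hc.eventually_lt (continuousAt_const (y := (0 : ℝ))) (by simpa using hneg)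
      filter_upwards [this.filter_mono nhdsWithin_le_nhds, self_mem_nhdsWithin] with t ht ht0
      rw [hexp]
      exact mul_nonpos_of_nonneg_of_nonpos (le_of_lt ht0) ht.le
    -- For an active two-sided bound `q * (a ⬝ᵥ x)` is nonzero, since otherwise the constraint would
    -- equal `d < 0`. A vanishing directional derivative then forces `a ⬝ᵥ v = 0`.
    · have hcurv : Q.q j * (dotProduct (Q.a j) v) ^ 2 = 0 := by
        rcases Q.affine_or_bound j with hq | ⟨hb, hd⟩
        · rw [hq, zero_mul]
        · have e : 2 * Q.q j * dotProduct (Q.a j) x * dotProduct (Q.a j) v = 0 := by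
            rw [← hzero, dotProduct, dotProduct, Finset.mul_sum]
            refine Finset.sum_congr rfl fun k _ => ?_
            simp only [conGrad, hb, Pi.zero_apply, add_zero, dotProduct]
            ring
          have hne : Q.q j * dotProduct (Q.a j) x ≠ 0 := by
            intro h
            have : Q.con j x = Q.d j := by
              rw [con, hb, zero_dotProduct, pow_two, ← mul_assoc, h]
              ring
            linarith
          have : dotProduct (Q.a j) v = 0 := by
            have e' : (Q.q j * dotProduct (Q.a j) x) * dotProduct (Q.a j) v = 0 := by linarith
            exact (mul_eq_zero.1 e').resolve_left hne
          rw [this]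
          ring
      refine Eventually.of_forall fun t => ?_
      rw [hexp, hzero, hcurv]
      simp

variable {Q} in
theorem continuous_obj : Continuous Q.obj := by
  unfold obj
  fun_prop

variable {Q} in
-- Positive weights make the sublevel sets of the objective bounded, so its minimum over the closed
-- feasible set is attained.
theorem exists_isMinOn {x₀ : κ → ℝ} (hx₀ : ∀ j, Q.con j x₀ ≤ 0) :
    ∃ x, (∀ j, Q.con j x ≤ 0) ∧ ∀ x', (∀ j, Q.con j x' ≤ 0) → Q.obj x ≤ Q.obj x' := by
  have hclosed : IsClosed {x | ∀ j, Q.con j x ≤ 0} := by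
    simp only [Set.ofPred_forall]
    exact isClosed_iInter fun j => isClosed_le (continuous_con j) continuous_const
  obtain ⟨x, hx, hmin⟩ := continuous_obj.continuousOn.exists_isMinOn' (f := Q.obj) hclosed hx₀ (by
    refine Eventually.filter_mono inf_le_left ?_
    have hbdd : Bornology.IsBounded {x | Q.obj x ≤ Q.obj x₀} := by
      refine (Metric.isBounded_iff_subset_closedBall Q.p).2
        ⟨∑ k, √(Q.obj x₀ / Q.w k), fun x hx => ?_⟩
      have hnn : ∀ k, 0 ≤ √(Q.obj x₀ / Q.w k) := fun k => Real.sqrt_nonneg _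
      refine (dist_pi_le_iff (Finset.sum_nonneg fun k _ => hnn k)).2 fun k => ?_
      refine le_trans ?_ (Finset.single_le_sum (fun k _ => hnn k) (Finset.mem_univ k))
      rw [Real.dist_eq]
      refine Real.abs_le_sqrt ?_
      rw [le_div_iff₀ (Q.w_pos k), mul_comm]
      exact (Q.mul_sq_le_wdist Q.p x k).trans hx
    have := hbdd.isCompact_closure.compl_mem_cocompact
    filter_upwards [this] with x hx
    by_contra! hlt
    exact hx (subset_closure hlt.le))
  exact ⟨x, hx, fun x' hx' => hmin hx'⟩

variable [Fintype ι]

/-- The Lagrangian function. -/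
def lag (x : κ → ℝ) (y : ι → ℝ) : ℝ := Q.obj x + ∑ j, y j * Q.con j x

/-- Partial derivatives of the Lagrangian function with respect to the primal variables. -/
def lagGrad (x : κ → ℝ) (y : ι → ℝ) (k : κ) : ℝ :=
  2 * Q.w k * (x k - Q.p k) + ∑ j, y j * Q.conGrad j x k

/-- The Karush-Kuhn-Tucker conditions. -/
structure IsKKT (x : κ → ℝ) (y : ι → ℝ) : Prop where
  nonneg : ∀ j, 0 ≤ y j
  feasible : ∀ j, Q.con j x ≤ 0
  slack : ∀ j, y j * Q.con j x = 0
  stationary : ∀ k, Q.lagGrad x y k = 0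

open Matrix in
theorem lag_expand (x x' : κ → ℝ) (y : ι → ℝ) :
    Q.lag x' y = Q.lag x y + ∑ k, Q.lagGrad x y k * (x' k - x k)
      + (Q.wdist x x' + ∑ j, y j * (Q.q j * (Q.a j ⬝ᵥ (x' - x)) ^ 2)) := by
  have e : ∑ k, Q.lagGrad x y k * (x' k - x k)
      = ∑ k, 2 * Q.w k * (x k - Q.p k) * (x' k - x k)
        + ∑ j, y j * ∑ k, Q.conGrad j x k * (x' k - x k) := by
    simp only [lagGrad, add_mul, Finset.sum_add_distrib, Finset.sum_mul, Finset.mul_sum]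
    rw [Finset.sum_comm]
    simp only [mul_assoc]
  rw [e]
  simp only [lag, Q.obj_expand x x', Q.con_expand _ x x', mul_add, Finset.sum_add_distrib]
  ring

/-- Along a coordinate axis the Lagrangian function is a quadratic polynomial. -/
theorem exists_lag_add_single [DecidableEq κ] (x : κ → ℝ) (y : ι → ℝ) (k : κ) :
    ∃ C, ∀ t : ℝ, Q.lag (x + Pi.single k t) y = Q.lag x y + t * Q.lagGrad x y k + t ^ 2 * C := by
  refine ⟨Q.w k + ∑ j, y j * (Q.q j * Q.a j k ^ 2), fun t => ?_⟩
  rw [Q.lag_expand x]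
  simp only [Pi.add_apply, add_sub_cancel_left, wdist, dotProduct_single]
  rw [Finset.sum_eq_single k (by intro i _ hi; simp [hi]) (by simp),
    Finset.sum_eq_single k (by intro i _ hi; simp [hi]) (by simp)]
  simp only [Pi.single_eq_same, mul_add, Finset.mul_sum]
  have : ∀ j, y j * (Q.q j * (Q.a j k * t) ^ 2) = t ^ 2 * (y j * (Q.q j * Q.a j k ^ 2)) :=
    fun j => by ring
  simp only [this]
  ring

/-- Strong convexity in `x`: for nonnegative multipliers the curvature of the constraints only
helps. -/
theorem lag_add_le (x x' : κ → ℝ) {y : ι → ℝ} (hy : ∀ j, 0 ≤ y j) :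
    Q.lag x y + ∑ k, Q.lagGrad x y k * (x' k - x k) + Q.wdist x x' ≤ Q.lag x' y := by
  rw [Q.lag_expand x x' y]
  have : 0 ≤ ∑ j, y j * (Q.q j * (dotProduct (Q.a j) (x' - x)) ^ 2) :=
    Finset.sum_nonneg fun j _ => mul_nonneg (hy j) (mul_nonneg (Q.q_nonneg j) (sq_nonneg _))
  linarith

variable {Q}

theorem IsKKT.lag_eq {x : κ → ℝ} {y : ι → ℝ} (h : Q.IsKKT x y) : Q.lag x y = Q.obj x := by
  simp [lag, h.slack]

theorem IsKKT.lag_add_wdist_le {x : κ → ℝ} {y : ι → ℝ} (h : Q.IsKKT x y) (x' : κ → ℝ) :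
    Q.lag x y + Q.wdist x x' ≤ Q.lag x' y := by
  have := Q.lag_add_le x x' h.nonneg
  simpa [h.stationary] using this

theorem IsKKT.lag_le {x : κ → ℝ} {y : ι → ℝ} (h : Q.IsKKT x y) {y' : ι → ℝ}
    (hy' : ∀ j, 0 ≤ y' j) : Q.lag x y' ≤ Q.lag x y := by
  rw [h.lag_eq, lag]
  have := Finset.sum_nonpos fun j (_ : j ∈ Finset.univ) =>
    mul_nonpos_of_nonneg_of_nonpos (hy' j) (h.feasible j)
  linarith

theorem IsKKT.obj_add_wdist_le {x : κ → ℝ} {y : ι → ℝ} (h : Q.IsKKT x y) {x' : κ → ℝ}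
    (hx' : ∀ j, Q.con j x' ≤ 0) : Q.obj x + Q.wdist x x' ≤ Q.obj x' := by
  have h1 := h.lag_add_wdist_le x'
  rw [h.lag_eq, lag] at h1
  have := Finset.sum_nonpos fun j (_ : j ∈ Finset.univ) =>
    mul_nonpos_of_nonneg_of_nonpos (h.nonneg j) (hx' j)
  linarith

/-- A saddle point of the Lagrangian function satisfies the Karush-Kuhn-Tucker conditions. -/
theorem isKKT_of_saddle {x : κ → ℝ} {y : ι → ℝ} (hy : ∀ j, 0 ≤ y j)
    (hmax : ∀ y', (∀ j, 0 ≤ y' j) → Q.lag x y' ≤ Q.lag x y)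
    (hmin : ∀ x', Q.lag x y ≤ Q.lag x' y) : Q.IsKKT x y := by
  classical
  -- Only one multiplier is varied. The value `y j + 1` yields feasibility, the value `0`
  -- complementary slackness.
  have hupd : ∀ j c, 0 ≤ c → (c - y j) * Q.con j x ≤ 0 := by
    intro j c hc
    have h1 := hmax (Function.update y j c) (fun i => by
      by_cases hi : i = j
      · subst hi; simpa using hc
      · simpa [hi] using hy i)
    have e : ∑ i, Function.update y j c i * Q.con i x
        = ∑ i, y i * Q.con i x + (c - y j) * Q.con j x := by
      rw [← Finset.add_sum_erase _ _ (Finset.mem_univ j),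
        ← Finset.add_sum_erase (a := j) _ (fun i => y i * Q.con i x) (Finset.mem_univ j)]
      have : ∑ i ∈ Finset.univ.erase j, Function.update y j c i * Q.con i x
          = ∑ i ∈ Finset.univ.erase j, y i * Q.con i x :=
        Finset.sum_congr rfl fun i hi => by rw [Function.update_of_ne (Finset.ne_of_mem_erase hi)]
      rw [this, Function.update_self]
      ring
    rw [lag, lag, e] at h1
    linarith
  have hfeas : ∀ j, Q.con j x ≤ 0 := fun j => by
    have := hupd j (y j + 1) (by linarith [hy j])
    linarith
  refine ⟨hy, hfeas, fun j => ?_, fun k => ?_⟩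
  · have := hupd j 0 le_rfl
    have := mul_nonpos_of_nonneg_of_nonpos (hy j) (hfeas j)
    linarith
  · obtain ⟨C, hC⟩ := Q.exists_lag_add_single x y k
    set g := Q.lagGrad x y k
    have hmin' : ∀ t : ℝ, Q.lag x y + 0 * g + 0 ^ 2 * C ≤ Q.lag x y + t * g + t ^ 2 * C := fun t => by
      rw [← hC, ← hC, Pi.single_zero, add_zero]
      exact hmin _
    exact IsLocalMin.hasDerivAt_eq_zero (Eventually.of_forall hmin') (hasDerivAt_affine_add_sq _ _ C)

/-- Multipliers exist at every minimizer. -/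
theorem exists_isKKT_of_isMinOn {x : κ → ℝ} (hx : ∀ j, Q.con j x ≤ 0)
    (hmin : ∀ x', (∀ j, Q.con j x' ≤ 0) → Q.obj x ≤ Q.obj x') : ∃ y, Q.IsKKT x y := by
  classical
  let grad : ι → (κ → ℝ) →ₗ[ℝ] ℝ := fun j => dotProductBilin ℝ ℝ (Q.conGrad j x)
  let descent : (κ → ℝ) →ₗ[ℝ] ℝ := dotProductBilin ℝ ℝ fun k => -(2 * Q.w k * (x k - Q.p k))
  obtain ⟨c, hc, hsum⟩ := exists_nonneg_sum_eq_of_forall_nonpos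
    (Finset.univ.filter fun j => Q.con j x = 0) grad descent (by
      intro v hv
      have hev : ∀ᶠ t in 𝓝[>] (0 : ℝ), ∀ j, Q.con j (x + t • v) ≤ 0 :=
        eventually_all.2 fun j => eventually_con_le (hx j) fun h0 => hv j (by simpa using h0)
      -- Minimality along `x + t • v`, divided by `t`; letting `t → 0` leaves the first-order
      -- inequality that Farkas' lemma requires.
      have hlin : ∀ᶠ t in 𝓝[>] (0 : ℝ), 0 ≤ -descent v + t * ∑ k, Q.w k * v k ^ 2 := by
        filter_upwards [hev, self_mem_nhdsWithin] with t ht ht0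
        have h1 := hmin _ ht
        rw [Q.obj_expand x (x + t • v)] at h1
        have e : ∑ k, 2 * Q.w k * (x k - Q.p k) * ((x + t • v) k - x k) + Q.wdist x (x + t • v)
            = t * (-descent v + t * ∑ k, Q.w k * v k ^ 2) := by
          simp only [wdist, descent, dotProductBilin_apply_apply, dotProduct, Pi.add_apply,
            Pi.smul_apply, smul_eq_mul, add_sub_cancel_left, ← Finset.sum_neg_distrib, mul_add,
            Finset.mul_sum]
          congr 1 <;> exact Finset.sum_congr rfl fun k _ => by ring
        have h2 : 0 ≤ t * (-descent v + t * ∑ k, Q.w k * v k ^ 2) := by linarith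
        exact nonneg_of_mul_nonneg_right h2 ht0
      have hlim : Tendsto (fun t : ℝ => -descent v + t * ∑ k, Q.w k * v k ^ 2) (𝓝[>] 0)
          (𝓝 (-descent v)) := by
        have : ContinuousAt (fun t : ℝ => -descent v + t * ∑ k, Q.w k * v k ^ 2) 0 := by fun_prop
        simpa using this.tendsto.mono_left nhdsWithin_le_nhds
      have := ge_of_tendsto hlim hlin
      linarith)
  refine ⟨fun j => if Q.con j x = 0 then c j else 0, fun j => ?_, hx, fun j => ?_, fun k => ?_⟩
  · split_ifs
    exacts [hc j, le_rfl]
  · split_ifs with h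
    · rw [h, mul_zero]
    · rw [zero_mul]
  · have := LinearMap.congr_fun hsum (Pi.single k 1)
    simp only [descent, grad, dotProductBilin_apply_apply, dotProduct_single, mul_one,
      LinearMap.coe_sum, Finset.sum_apply, LinearMap.smul_apply, smul_eq_mul] at this
    rw [Finset.sum_filter] at this
    simp only [lagGrad, ite_mul, zero_mul]
    linarith

/-- The squared distance to a point satisfying the Karush-Kuhn-Tucker conditions is dissipated by
the saddle point dynamics. -/
theorem IsKKT.dissipation {x' : κ → ℝ} {y' : ι → ℝ} (h : Q.IsKKT x' y') (x : κ → ℝ) {y : ι → ℝ}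
    (hy : ∀ j, 0 ≤ y j) :
    ∑ k, (x k - x' k) * -Q.lagGrad x y k + ∑ j, (y j - y' j) * projPlus (Q.con j x) (y j)
      ≤ -(2 * Q.wdist x' x - ∑ j, y j * Q.con j x') := by
  have h1 : ∑ j, (y j - y' j) * projPlus (Q.con j x) (y j) ≤ ∑ j, (y j - y' j) * Q.con j x :=
    Finset.sum_le_sum fun j _ => projPlus_mul_le (hy j) (h.nonneg j)
  -- Strong convexity enters twice, here for the multipliers `y` and next for `y'`; this accounts
  -- for the factor 2 in front of `wdist`.
  have h2 := Q.lag_add_le x x' hy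
  have h3 := h.lag_add_wdist_le x
  rw [h.lag_eq] at h3
  have e1 : ∑ k, (x k - x' k) * -Q.lagGrad x y k = ∑ k, Q.lagGrad x y k * (x' k - x k) :=
    Finset.sum_congr rfl fun k _ => by ring
  have e2 : Q.wdist x x' = Q.wdist x' x := Finset.sum_congr rfl fun k _ => by ring
  rw [e1]
  rw [e2] at h2
  have e3 : ∑ j, (y j - y' j) * Q.con j x = ∑ j, y j * Q.con j x - ∑ j, y' j * Q.con j x := by
    simp only [sub_mul, Finset.sum_sub_distrib]
  rw [e3] at h1
  rw [lag, lag] at h2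
  rw [lag] at h3
  linarith

end QuadProgram

/-! ### The saddle point flow: dissipation, convergence and existence -/

theorem projPlus_mul_of_nonneg {c : ℝ} (hc : 0 ≤ c) (x y : ℝ) :
    projPlus (c * x) y = c * projPlus x y := by
  unfold projPlus
  split_ifs
  · rfl
  · rw [mul_max_of_nonneg _ _ hc, mul_zero]

theorem abs_projPlus_le (x y : ℝ) : |projPlus x y| ≤ |x| := by
  unfold projPlus
  split_ifs
  · exact le_rfl
  · rw [abs_of_nonneg (le_max_right _ _)]
    exact max_le (le_abs_self x) (abs_nonneg x)

namespace QuadProgram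

variable {κ ι : Type*} [Fintype κ] [Fintype ι] (Q : QuadProgram κ ι)

/-- `x` and `y` solve the saddle point dynamics with the time-dependent speed `c`. -/
structure IsFlow (c : ℝ → ℝ) (x : ℝ → κ → ℝ) (y : ℝ → ι → ℝ) : Prop where
  absCont_primal : ∀ k T, 0 < T → AbsolutelyContinuousOnInterval (fun t => x t k) 0 T
  absCont_dual : ∀ j T, 0 < T → AbsolutelyContinuousOnInterval (fun t => y t j) 0 T
  nonneg : ∀ t, 0 ≤ t → ∀ j, 0 ≤ y t j
  ode : ∀ᵐ t : ℝ, 0 < t →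
    (∀ k, HasDerivAt (fun s => x s k) (c t * -Q.lagGrad (x t) (y t) k) t) ∧
    ∀ j, HasDerivAt (fun s => y s j) (c t * projPlus (Q.con j (x t)) (y t j)) t

/-- Squared distance of `(x, y)` to `(x', y')`. -/
def energy (x' : κ → ℝ) (y' : ι → ℝ) (x : κ → ℝ) (y : ι → ℝ) : ℝ :=
  ∑ k, (x k - x' k) ^ 2 + ∑ j, (y j - y' j) ^ 2

/-- The rate at which the energy is dissipated. -/
def gap (x' x : κ → ℝ) (y : ι → ℝ) : ℝ := 2 * Q.wdist x' x - ∑ j, y j * Q.con j x'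

theorem sq_primal_le_energy (x' : κ → ℝ) (y' : ι → ℝ) (x : κ → ℝ) (y : ι → ℝ) (k : κ) :
    (x k - x' k) ^ 2 ≤ energy x' y' x y := by
  have h1 := Finset.single_le_sum (f := fun k => (x k - x' k) ^ 2) (fun k _ => sq_nonneg _)
    (Finset.mem_univ k)
  have h2 : 0 ≤ ∑ j, (y j - y' j) ^ 2 := Finset.sum_nonneg fun j _ => sq_nonneg _
  unfold energy
  linarith

theorem sq_dual_le_energy (x' : κ → ℝ) (y' : ι → ℝ) (x : κ → ℝ) (y : ι → ℝ) (j : ι) :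
    (y j - y' j) ^ 2 ≤ energy x' y' x y := by
  have h1 := Finset.single_le_sum (f := fun j => (y j - y' j) ^ 2) (fun j _ => sq_nonneg _)
    (Finset.mem_univ j)
  have h2 : 0 ≤ ∑ k, (x k - x' k) ^ 2 := Finset.sum_nonneg fun k _ => sq_nonneg _
  unfold energy
  linarith

theorem energy_nonneg (x' : κ → ℝ) (y' : ι → ℝ) (x : κ → ℝ) (y : ι → ℝ) :
    0 ≤ energy x' y' x y :=
  add_nonneg (Finset.sum_nonneg fun _ _ => sq_nonneg _) (Finset.sum_nonneg fun _ _ => sq_nonneg _)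

theorem continuous_energy (x' : κ → ℝ) (y' : ι → ℝ) :
    Continuous fun z : (κ → ℝ) × (ι → ℝ) => energy x' y' z.1 z.2 := by
  unfold energy
  fun_prop

theorem continuous_gap (x' : κ → ℝ) :
    Continuous fun z : (κ → ℝ) × (ι → ℝ) => Q.gap x' z.1 z.2 := by
  unfold gap wdist
  fun_prop

theorem continuous_lagGrad (k : κ) :
    Continuous fun z : (κ → ℝ) × (ι → ℝ) => Q.lagGrad z.1 z.2 k := by
  unfold lagGrad conGrad dotProduct
  fun_prop

variable {Q} {c : ℝ → ℝ} {x : ℝ → κ → ℝ} {y : ℝ → ι → ℝ} {x' : κ → ℝ} {y' : ι → ℝ}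

theorem IsKKT.gap_nonneg (h : Q.IsKKT x' y') (x : κ → ℝ) {y : ι → ℝ} (hy : ∀ j, 0 ≤ y j) :
    0 ≤ Q.gap x' x y := by
  have h1 := Finset.sum_nonpos fun j (_ : j ∈ Finset.univ) =>
    mul_nonpos_of_nonneg_of_nonpos (hy j) (h.feasible j)
  have h2 := Q.wdist_nonneg x' x
  unfold gap
  linarith

theorem IsFlow.absCont_energy (hf : Q.IsFlow c x y) (x' : κ → ℝ) (y' : ι → ℝ) {T : ℝ}
    (hT : 0 < T) : AbsolutelyContinuousOnInterval (fun t => energy x' y' (x t) (y t)) 0 T := by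
  have hsq : ∀ (f : ℝ → ℝ) (r : ℝ), AbsolutelyContinuousOnInterval f 0 T →
      AbsolutelyContinuousOnInterval (fun t => (f t - r) ^ 2) 0 T := by
    intro f r h
    have h1 : AbsolutelyContinuousOnInterval (fun t => f t - r) 0 T :=
      (LipschitzWith.of_dist_le_mul (K := 1) (f := fun a : ℝ => a - r) fun a b => by
        simp).comp_absolutelyContinuousOnInterval h
    have e : (fun t => (f t - r) ^ 2) = (fun t => f t - r) * fun t => f t - r := by
      funext t
      exact pow_two _
    rw [e]
    exact h1.mul h1
  exact (absolutelyContinuousOnInterval_finset_sum _ fun k _ =>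
    hsq _ _ (hf.absCont_primal k T hT)).add (absolutelyContinuousOnInterval_finset_sum _ fun j _ =>
    hsq _ _ (hf.absCont_dual j T hT))

/-- A nonnegative speed `c` merely rescales the dissipation, so the estimate also covers the flow of
a cut-off field. -/
theorem IsFlow.exists_deriv_energy (hf : Q.IsFlow c x y) (hc : ∀ t, 0 ≤ t → 0 ≤ c t)
    (h : Q.IsKKT x' y') :
    ∃ e : ℝ → ℝ, (∀ᵐ t, 0 < t → HasDerivAt (fun s => energy x' y' (x s) (y s)) (e t) t) ∧
      ∀ t, 0 ≤ t → e t ≤ -(2 * (c t * Q.gap x' (x t) (y t))) := by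
  refine ⟨fun t => 2 * (c t * (∑ k, (x t k - x' k) * -Q.lagGrad (x t) (y t) k
    + ∑ j, (y t j - y' j) * projPlus (Q.con j (x t)) (y t j))), ?_, fun t ht => ?_⟩
  · filter_upwards [hf.ode] with t ht ht0
    obtain ⟨hx, hy⟩ := ht ht0
    have h1 := (HasDerivAt.fun_sum (u := Finset.univ) fun k _ => ((hx k).sub_const (x' k)).pow 2).add
      (HasDerivAt.fun_sum (u := Finset.univ) fun j _ => ((hy j).sub_const (y' j)).pow 2)
    convert! h1 using 1
    simp only [mul_add, Finset.mul_sum]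
    congr 1 <;> refine Finset.sum_congr rfl fun _ _ => ?_ <;> norm_num <;> ring
  · have := mul_le_mul_of_nonneg_left (h.dissipation (x t) (hf.nonneg t ht)) (hc t ht)
    rw [gap]
    linarith

theorem IsFlow.energy_le (hf : Q.IsFlow c x y) (hc : ∀ t, 0 ≤ t → 0 ≤ c t) (h : Q.IsKKT x' y')
    {s t : ℝ} (hs : 0 ≤ s) (hst : s ≤ t) :
    energy x' y' (x t) (y t) ≤ energy x' y' (x s) (y s) := by
  obtain ⟨e, he, hle⟩ := hf.exists_deriv_energy hc h
  obtain ⟨_, hinteg⟩ := integral_eq_sub_of_ae_hasDerivAt (fun T hT => hf.absCont_energy x' y' hT) he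
    hs hst
  have : ∫ r in s..t, e r ≤ 0 := by
    rw [← neg_nonneg, ← intervalIntegral.integral_neg]
    refine intervalIntegral.integral_nonneg hst fun r hr => ?_
    have hr0 := hs.trans hr.1
    have := hle r hr0
    have := mul_nonneg (hc r hr0) (h.gap_nonneg (x r) (hf.nonneg r hr0))
    linarith
  linarith

theorem IsFlow.continuousOn (hf : Q.IsFlow c x y) :
    ContinuousOn (fun t => (x t, y t)) (Set.Ici 0) := by
  have hmem : ∀ t : ℝ, 0 ≤ t → Set.uIcc 0 (t + 1) ∈ 𝓝[Set.Ici 0] t := fun t ht => by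
    rw [Set.uIcc_of_le (by linarith)]
    exact mem_nhdsWithin.2 ⟨Set.Iio (t + 1), isOpen_Iio, lt_add_one t, fun r hr => ⟨hr.2, hr.1.le⟩⟩
  have hsub : ∀ t : ℝ, 0 ≤ t → t ∈ Set.uIcc 0 (t + 1) := fun t ht => by
    rw [Set.uIcc_of_le (by linarith)]
    exact ⟨ht, by linarith⟩
  refine ContinuousOn.prodMk (continuousOn_pi.2 fun k t ht => ?_) (continuousOn_pi.2 fun j t ht => ?_)
  · have ht0 : 0 ≤ t := ht
    exact (((hf.absCont_primal k (t + 1) (by linarith)).continuousOn) t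
      (hsub t ht)).mono_of_mem_nhdsWithin (hmem t ht)
  · have ht0 : 0 ≤ t := ht
    exact (((hf.absCont_dual j (t + 1) (by linarith)).continuousOn) t
      (hsub t ht)).mono_of_mem_nhdsWithin (hmem t ht)

theorem IsFlow.integral_gap_le (hf : Q.IsFlow (fun _ => 1) x y) (h : Q.IsKKT x' y') {t : ℝ}
    (ht : 0 ≤ t) : 2 * ∫ r in (0)..t, Q.gap x' (x r) (y r) ≤ energy x' y' (x 0) (y 0) := by
  obtain ⟨e, he, hle⟩ := hf.exists_deriv_energy (fun _ _ => zero_le_one) h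
  obtain ⟨hei, hinteg⟩ := integral_eq_sub_of_ae_hasDerivAt (fun T hT => hf.absCont_energy x' y' hT) he
    le_rfl ht
  have hgi : IntervalIntegrable (fun r => Q.gap x' (x r) (y r)) volume 0 t := by
    refine ContinuousOn.intervalIntegrable ?_
    rw [Set.uIcc_of_le ht]
    exact ((Q.continuous_gap x').comp_continuousOn hf.continuousOn).mono Set.Icc_subset_Ici_self
  have h1 : ∫ r in (0)..t, e r ≤ ∫ r in (0)..t, -2 * Q.gap x' (x r) (y r) := by
    refine intervalIntegral.integral_mono_on ht hei (hgi.const_mul _) fun r hr => ?_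
    have := hle r hr.1
    linarith
  rw [hinteg, intervalIntegral.integral_const_mul] at h1
  have := energy_nonneg x' y' (x t) (y t)
  linarith

theorem dist_le_sqrt_energy (x' : κ → ℝ) (y' : ι → ℝ) (x : κ → ℝ) (y : ι → ℝ) :
    dist (x, y) (x', y') ≤ √(energy x' y' x y) := by
  rw [Prod.dist_eq]
  refine max_le ((dist_pi_le_iff (Real.sqrt_nonneg _)).2 fun k => ?_)
    ((dist_pi_le_iff (Real.sqrt_nonneg _)).2 fun j => ?_)
  · exact Real.abs_le_sqrt (sq_primal_le_energy x' y' x y k)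
  · exact Real.abs_le_sqrt (sq_dual_le_energy x' y' x y j)

theorem IsFlow.mem_closedBall (hf : Q.IsFlow c x y) (hc : ∀ t, 0 ≤ t → 0 ≤ c t)
    (h : Q.IsKKT x' y') {t : ℝ} (ht : 0 ≤ t) :
    (x t, y t) ∈ Metric.closedBall (x', y') √(energy x' y' (x 0) (y 0)) :=
  (dist_le_sqrt_energy x' y' (x t) (y t)).trans
    (Real.sqrt_le_sqrt (hf.energy_le hc h le_rfl ht))

theorem abs_sub_le_of_ae_hasDerivAt {f f' : ℝ → ℝ} {C : ℝ}
    (hf : ∀ T, 0 < T → AbsolutelyContinuousOnInterval f 0 T)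
    (h : ∀ᵐ t, 0 < t → HasDerivAt f (f' t) t) (hC : ∀ t, 0 ≤ t → |f' t| ≤ C) {s t : ℝ}
    (hs : 0 ≤ s) (hst : s ≤ t) : |f t - f s| ≤ C * (t - s) := by
  rw [← (integral_eq_sub_of_ae_hasDerivAt hf h hs hst).2]
  have := intervalIntegral.norm_integral_le_of_norm_le_const (f := f') (a := s) (b := t) (C := C)
    fun r hr => by
      rw [Set.uIoc_of_le hst] at hr
      exact hC r (hs.trans hr.1.le)
  rwa [abs_of_nonneg (sub_nonneg.2 hst)] at this

/-- The energy confines the solution to a compact ball, where the unprojected field is bounded, and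
projection does not increase absolute values. -/
theorem IsFlow.exists_lipschitzOnWith (hf : Q.IsFlow (fun _ => 1) x y) (h : Q.IsKKT x' y') :
    ∃ K, LipschitzOnWith K (fun t => (x t, y t)) (Set.Ici 0) := by
  obtain ⟨C, hC⟩ := (isCompact_closedBall (x', y')
    √(energy x' y' (x 0) (y 0))).exists_bound_of_continuousOn
    (f := fun z => ((fun k => Q.lagGrad z.1 z.2 k), fun j => Q.con j z.1))
    (((continuous_pi fun k => Q.continuous_lagGrad k).prodMk
      (continuous_pi fun j => (continuous_con j).comp continuous_fst)).continuousOn)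
  have hmem := fun t ht => hf.mem_closedBall (fun _ _ => zero_le_one) h (t := t) ht
  have hC0 : 0 ≤ C := (norm_nonneg _).trans (hC _ (hmem 0 le_rfl))
  have hx : ∀ k t, 0 ≤ t → |1 * -Q.lagGrad (x t) (y t) k| ≤ C := by
    intro k t ht
    rw [one_mul, abs_neg]
    exact (norm_le_pi_norm (fun k => Q.lagGrad (x t) (y t) k) k).trans
      ((norm_fst_le _).trans (hC _ (hmem t ht)))
  have hy : ∀ j t, 0 ≤ t → |1 * projPlus (Q.con j (x t)) (y t j)| ≤ C := by
    intro j t ht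
    rw [one_mul]
    exact (abs_projPlus_le _ _).trans ((norm_le_pi_norm (fun j => Q.con j (x t)) j).trans
      ((norm_snd_le _).trans (hC _ (hmem t ht))))
  have hordered : ∀ s t, 0 ≤ s → s ≤ t → dist (x s, y s) (x t, y t) ≤ C * dist s t := by
    intro s t hs hst
    have hnn : 0 ≤ C * (t - s) := mul_nonneg hC0 (sub_nonneg.2 hst)
    rw [dist_comm, dist_comm s t, Real.dist_eq, abs_of_nonneg (sub_nonneg.2 hst), Prod.dist_eq]
    refine max_le ((dist_pi_le_iff hnn).2 fun k => ?_) ((dist_pi_le_iff hnn).2 fun j => ?_)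
    · exact abs_sub_le_of_ae_hasDerivAt (hf.absCont_primal k)
        (hf.ode.mono fun t ht ht0 => (ht ht0).1 k) (hx k) hs hst
    · exact abs_sub_le_of_ae_hasDerivAt (hf.absCont_dual j)
        (hf.ode.mono fun t ht ht0 => (ht ht0).2 j) (hy j) hs hst
  refine ⟨C.toNNReal, LipschitzOnWith.of_dist_le_mul fun s hs t ht => ?_⟩
  rw [Real.coe_toNNReal _ hC0]
  rcases le_total s t with hst | hts
  · exact hordered s t hs hst
  · rw [dist_comm, dist_comm s t]
    exact hordered t s ht hts

theorem IsFlow.uniformContinuousOn_comp (hf : Q.IsFlow (fun _ => 1) x y) (h : Q.IsKKT x' y')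
    {g : (κ → ℝ) × (ι → ℝ) → ℝ} (hg : Continuous g) :
    UniformContinuousOn (fun t => g (x t, y t)) (Set.Ici 0) := by
  obtain ⟨K, hK⟩ := hf.exists_lipschitzOnWith h
  exact ((isCompact_closedBall (x', y') _).uniformContinuousOn_of_continuous hg.continuousOn).comp
    hK.uniformContinuousOn fun t ht => hf.mem_closedBall (fun _ _ => zero_le_one) h ht

/-- The integral of the nonnegative gap is monotone and bounded by half the initial energy, hence
convergent, and the gap is uniformly continuous in time: Barbalat's lemma applies. -/
theorem IsFlow.tendsto_gap (hf : Q.IsFlow (fun _ => 1) x y) (h : Q.IsKKT x' y') :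
    Tendsto (fun t => Q.gap x' (x t) (y t)) atTop (𝓝 0) := by
  have huc := hf.uniformContinuousOn_comp h (Q.continuous_gap x')
  have hinteg : ∀ s t, 0 ≤ s → s ≤ t →
      IntervalIntegrable (fun r => Q.gap x' (x r) (y r)) volume s t := by
    intro s t hs hst
    refine (huc.continuousOn.mono ?_).intervalIntegrable
    rw [Set.uIcc_of_le hst]
    exact fun r hr => hs.trans hr.1
  have hsub : ∀ s t, 0 ≤ s → s ≤ t → ∫ r in s..t, Q.gap x' (x r) (y r)
      = (∫ r in (0)..(max t 0), Q.gap x' (x r) (y r))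
        - ∫ r in (0)..(max s 0), Q.gap x' (x r) (y r) := by
    intro s t hs hst
    rw [max_eq_left hs, max_eq_left (hs.trans hst)]
    exact (intervalIntegral.integral_interval_sub_left (hinteg 0 t le_rfl (hs.trans hst))
      (hinteg 0 s le_rfl hs)).symm
  have hmono : Monotone fun t => ∫ r in (0)..(max t 0), Q.gap x' (x r) (y r) := by
    intro s t hst
    have h1 := hsub (max s 0) (max t 0) (le_max_right _ _) (max_le_max_right 0 hst)
    have h2 : 0 ≤ ∫ r in (max s 0)..(max t 0), Q.gap x' (x r) (y r) :=
      intervalIntegral.integral_nonneg (max_le_max_right 0 hst) fun r hr =>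
        h.gap_nonneg _ (hf.nonneg r ((le_max_right _ _).trans hr.1))
    simp only [max_eq_left (le_max_right _ _)] at h1
    simp only
    linarith
  have hbdd : BddAbove (Set.range fun t => ∫ r in (0)..(max t 0), Q.gap x' (x r) (y r)) := by
    refine ⟨energy x' y' (x 0) (y 0) / 2, ?_⟩
    rintro _ ⟨t, rfl⟩
    have := hf.integral_gap_le h (le_max_right t 0)
    simp only
    linarith
  exact tendsto_zero_of_tendsto_of_integral_eq_sub (tendsto_atTop_ciSup hmono hbdd) huc hsub

theorem IsFlow.tendsto_primal (hf : Q.IsFlow (fun _ => 1) x y) (h : Q.IsKKT x' y') (k : κ) :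
    Tendsto (fun t => x t k) atTop (𝓝 (x' k)) := by
  have hsq : Tendsto (fun t => (x t k - x' k) ^ 2) atTop (𝓝 0) := by
    have hlim : Tendsto (fun t => Q.gap x' (x t) (y t) / Q.w k) atTop (𝓝 0) := by
      simpa using (hf.tendsto_gap h).div_const (Q.w k)
    refine squeeze_zero' (Eventually.of_forall fun t => sq_nonneg _) ?_ hlim
    filter_upwards [eventually_ge_atTop 0] with t ht
    rw [le_div_iff₀ (Q.w_pos k), mul_comm]
    have h1 := Q.mul_sq_le_wdist x' (x t) k
    have h2 := Q.wdist_nonneg x' (x t)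
    have h3 := Finset.sum_nonpos fun j (_ : j ∈ Finset.univ) =>
      mul_nonpos_of_nonneg_of_nonpos (hf.nonneg t ht j) (h.feasible j)
    unfold gap
    linarith
  have habs : Tendsto (fun t => |x t k - x' k|) atTop (𝓝 0) := by
    simpa [Real.sqrt_sq_eq_abs] using hsq.sqrt
  have := (tendsto_zero_iff_abs_tendsto_zero _).2 habs
  simpa using this.add_const (x' k)

/-- Barbalat's lemma for the primal coordinate, which converges and whose velocity is continuous in
the state. The dual velocity is discontinuous and would not qualify. -/
theorem IsFlow.tendsto_lagGrad (hf : Q.IsFlow (fun _ => 1) x y) (h : Q.IsKKT x' y') (k : κ) :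
    Tendsto (fun t => Q.lagGrad (x t) (y t) k) atTop (𝓝 0) := by
  have := tendsto_zero_of_tendsto_of_integral_eq_sub (hf.tendsto_primal h k)
    (hf.uniformContinuousOn_comp h (g := fun z => -Q.lagGrad z.1 z.2 k) (Q.continuous_lagGrad k).neg) fun s t hs hst =>
      (integral_eq_sub_of_ae_hasDerivAt (hf.absCont_primal k)
        (hf.ode.mono fun t ht ht0 => by simpa only [one_mul] using (ht ht0).1 k) hs hst).2
  simpa using this.neg

/-- Every solution of the saddle point dynamics converges to a point that satisfies the
Karush-Kuhn-Tucker conditions. -/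
theorem IsFlow.exists_tendsto (hf : Q.IsFlow (fun _ => 1) x y) (h : Q.IsKKT x' y') :
    ∃ y'', Q.IsKKT x' y'' ∧ Tendsto (fun t => (x t, y t)) atTop (𝓝 (x', y'')) := by
  obtain ⟨⟨a, y''⟩, -, φ, hφ, hlim⟩ := (isCompact_closedBall (x', y') _).tendsto_subseq
    (x := fun n : ℕ => (x n, y n))
    fun n => hf.mem_closedBall (fun _ _ => zero_le_one) h n.cast_nonneg
  have hφtop : Tendsto (fun n => ((φ n : ℕ) : ℝ)) atTop atTop :=
    tendsto_natCast_atTop_atTop.comp hφ.tendsto_atTop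
  have hval : ∀ (g : (κ → ℝ) × (ι → ℝ) → ℝ) (l : ℝ), Continuous g →
      Tendsto (fun t => g (x t, y t)) atTop (𝓝 l) → g (a, y'') = l := fun g l hg hgl =>
    tendsto_nhds_unique ((hg.tendsto _).comp hlim) (hgl.comp hφtop)
  obtain rfl : a = x' := funext fun k =>
    hval (fun z => z.1 k) _ (by fun_prop) (hf.tendsto_primal h k)
  have hy'' : ∀ j, 0 ≤ y'' j := fun j =>
    ge_of_tendsto (((by fun_prop : Continuous fun z : (κ → ℝ) × (ι → ℝ) => z.2 j).tendsto _).comp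
      hlim) (Eventually.of_forall fun n => hf.nonneg _ (Nat.cast_nonneg _) j)
  have hgap : Q.gap a a y'' = 0 := hval (fun z => Q.gap a z.1 z.2) _ (Q.continuous_gap a)
    (hf.tendsto_gap h)
  -- At the primal optimum the gap reduces to a sum of nonnegative slackness terms, so each of them
  -- vanishes.
  have hsum : ∑ j, -(y'' j * Q.con j a) = 0 := by
    simpa [gap, wdist] using hgap
  have hslack := (Finset.sum_eq_zero_iff_of_nonneg fun j _ =>
    neg_nonneg.2 (mul_nonpos_of_nonneg_of_nonpos (hy'' j) (h.feasible j))).1 hsum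
  have hK : Q.IsKKT a y'' := ⟨hy'', h.feasible, fun j => neg_eq_zero.1 (hslack j (Finset.mem_univ j)),
    fun k => hval (fun z => Q.lagGrad z.1 z.2 k) _ (Q.continuous_lagGrad k)
      (hf.tendsto_lagGrad h k)⟩
  refine ⟨y'', hK, ?_⟩
  have hself : energy a y'' a y'' = 0 := by simp [energy]
  -- The energy relative to the limit point is nonincreasing, because that point is itself a
  -- Karush-Kuhn-Tucker pair, and it tends to zero along the subsequence.
  have henergy : Tendsto (fun t => energy a y'' (x t) (y t)) atTop (𝓝 0) := by
    have hsub : Tendsto (fun n => energy a y'' (x (φ n)) (y (φ n))) atTop (𝓝 0) := by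
      have := ((continuous_energy a y'').tendsto (a, y'')).comp hlim
      rwa [hself] at this
    rw [Metric.tendsto_nhds]
    intro ε hε
    obtain ⟨n, hn⟩ := ((Metric.tendsto_nhds.1 hsub) ε hε).exists
    filter_upwards [eventually_ge_atTop ((φ n : ℕ) : ℝ)] with t ht
    have h1 := hf.energy_le (fun _ _ => zero_le_one) hK (Nat.cast_nonneg (φ n)) ht
    rw [Real.dist_eq, sub_zero, abs_of_nonneg (energy_nonneg _ _ _ _)] at hn ⊢
    linarith
  rw [tendsto_iff_dist_tendsto_zero]
  refine squeeze_zero (fun _ => dist_nonneg) (fun t => dist_le_sqrt_energy _ _ _ _) ?_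
  simpa using henergy.sqrt

variable (Q) in
/-- Right-hand side of the saddle point dynamics before projection. -/
def field (u : κ ⊕ ι → ℝ) : κ ⊕ ι → ℝ :=
  Sum.elim (fun k => -Q.lagGrad (fun k => u (Sum.inl k)) (fun j => u (Sum.inr j)) k)
    fun j => Q.con j fun k => u (Sum.inl k)

theorem contDiff_field : ContDiff ℝ 1 Q.field := by
  refine contDiff_pi.2 fun i => ?_
  rcases i with k | j
  · simp only [field, Sum.elim_inl, lagGrad, conGrad, dotProduct]
    fun_prop
  · simp only [field, Sum.elim_inr, con, dotProduct]
    fun_prop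

/-- The saddle point dynamics has a solution for every initial state. -/
theorem exists_isFlow (h : Q.IsKKT x' y') (u₀ : κ ⊕ ι → ℝ) (h₀ : ∀ j, 0 ≤ u₀ (Sum.inr j)) :
    ∃ u : ℝ → κ ⊕ ι → ℝ, u 0 = u₀ ∧ (∃ K, LipschitzOnWith K u (Set.Ici 0)) ∧
      Q.IsFlow (fun _ => 1) (fun t k => u t (Sum.inl k)) fun t j => u t (Sum.inr j) := by
  classical
  set r := √(energy x' y' (fun k => u₀ (Sum.inl k)) fun j => u₀ (Sum.inr j)) with hr
  have hr0 : 0 ≤ r := Real.sqrt_nonneg _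
  -- The cutoff must equal one on the ball of radius `r` that the energy estimate provides; `r + 1`
  -- is used because the inner radius must be positive and `r` may be zero.
  let φ : ContDiffBump (Sum.elim x' y') := ⟨r + 1, r + 2, by linarith, by linarith⟩
  have hsupp : HasCompactSupport fun u => φ u • Q.field u := φ.hasCompactSupport.smul_right
  have hsmooth : ContDiff ℝ 1 fun u => φ u • Q.field u := φ.contDiff.smul contDiff_field
  obtain ⟨L, hL⟩ := hsmooth.lipschitzWith_of_hasCompactSupport hsupp one_ne_zero
  obtain ⟨M, hM⟩ := hsupp.exists_bound_of_continuous hsmooth.continuous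
  obtain ⟨u, hu0, ⟨K, hK⟩, hnn, hode⟩ := exists_reflected_solution
    (fun i : κ ⊕ ι => i.isRight = true) hL hM u₀ (by
      rintro (k | j) hi
      · simp at hi
      · exact h₀ j)
  have hac : ∀ i T, 0 < T → AbsolutelyContinuousOnInterval (fun t => u t i) 0 T := by
    intro i T hT
    have hacu : AbsolutelyContinuousOnInterval u 0 T := by
      refine LipschitzOnWith.absolutelyContinuousOnInterval (hK.mono ?_)
      rw [Set.uIcc_of_le hT.le]
      exact Set.Icc_subset_Ici_self
    exact LipschitzWith.comp_absolutelyContinuousOnInterval (g := fun a : κ ⊕ ι → ℝ => a i)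
      (LipschitzWith.eval i) hacu
  -- As `φ ≥ 0`, the factor passes through the projection, and the solution for the cut-off field is
  -- a saddle point flow with speed `φ (u t)`.
  have hcut : Q.IsFlow (fun t => φ (u t)) (fun t k => u t (Sum.inl k))
      fun t j => u t (Sum.inr j) := by
    refine ⟨fun k => hac _, fun j => hac _, fun t ht j => hnn t ht _ rfl, ?_⟩
    filter_upwards [hode] with t ht ht0
    refine ⟨fun k => ?_, fun j => ?_⟩
    · simpa [field] using ht ht0 (Sum.inl k)
    · rw [← projPlus_mul_of_nonneg φ.nonneg]
      simpa [field] using ht ht0 (Sum.inr j)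
  have hone : ∀ t, 0 ≤ t → φ (u t) = 1 := by
    intro t ht
    refine φ.one_of_mem_closedBall ?_
    have hmem := hcut.mem_closedBall (fun _ _ => φ.nonneg) h ht
    rw [hu0, ← hr, Metric.mem_closedBall, Prod.dist_eq, max_le_iff, dist_pi_le_iff hr0,
      dist_pi_le_iff hr0] at hmem
    refine (dist_pi_le_iff (by positivity)).2 ?_
    rintro (k | j)
    · exact (hmem.1 k).trans (by simp [φ])
    · exact (hmem.2 j).trans (by simp [φ])
  refine ⟨u, hu0, ⟨K, hK⟩, hcut.absCont_primal, hcut.absCont_dual, hcut.nonneg, ?_⟩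
  filter_upwards [hcut.ode] with t ht ht0
  simpa only [hone t ht0.le] using ht ht0

end QuadProgram

/-! ### Translation of load shedding into a quadratic program -/

/-- The coordinates of the gradient are the partial derivatives. -/
theorem gradient_apply_of_hasDerivAt {κ : Type*} [Fintype κ] [DecidableEq κ]
    {f : EuclideanSpace ℝ κ → ℝ} {x : EuclideanSpace ℝ κ} (hf : DifferentiableAt ℝ f x) {k : κ}
    {g : ℝ} (hg : HasDerivAt (fun t : ℝ => f (x + t • EuclideanSpace.single k (1 : ℝ))) g 0) :
    gradient f x k = g := by
  have h1 : gradient f x k = fderiv ℝ f x (EuclideanSpace.single k (1 : ℝ)) := by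
    rw [← InnerProductSpace.toDual_symm_apply, ← gradient, EuclideanSpace.inner_single_right]
    simp
  rw [h1]
  have h2 : HasLineDerivAt ℝ f (fderiv ℝ f x (EuclideanSpace.single k (1 : ℝ))) x
    (EuclideanSpace.single k (1 : ℝ)) := hf.hasFDerivAt.hasLineDerivAt _
  exact HasDerivAt.unique h2 hg

namespace PowerGrid

variable {nb n : ℕ} (N : PowerGrid nb n)

/-- The load-shedding problem as a quadratic program. -/
def program (m : ℕ) (hW : ∀ i, 0 < N.W i) (hσ : ∀ e : N.Edge, 0 < N.σ e.1.1 e.1.2) :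
    QuadProgram (Fin nb) (N.Edge ⊕ Fin nb ⊕ Fin nb) where
  w i := N.W i ^ 2
  p := N.P0.ofLp
  a := Sum.elim (fun e k => N.nodal (N.admittance m) e.1.1 e.1.2 *
    (N.starInv (N.admittance m) e.1.1 k - N.starInv (N.admittance m) e.1.2 k)) 0
  b := Sum.elim 0 (Sum.elim (fun i => Pi.single i 1) fun i => Pi.single i (-1))
  q := Sum.elim 1 0
  d := Sum.elim (fun e => -N.σ e.1.1 e.1.2 ^ 2) (Sum.elim (fun i => -N.Phi i) N.Plo)
  w_pos i := pow_pos (hW i) 2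
  q_nonneg := by rintro (e | i) <;> simp
  affine_or_bound := by
    rintro (e | i)
    · exact Or.inr ⟨rfl, neg_lt_zero.2 (pow_pos (hσ e) 2)⟩
    · exact Or.inl rfl

/-- The multipliers of a state as one vector. -/
def mult (lam : EuclideanSpace ℝ N.Edge) (tu tl : EuclideanSpace ℝ (Fin nb)) :
    N.Edge ⊕ Fin nb ⊕ Fin nb → ℝ :=
  Sum.elim lam.ofLp (Sum.elim tu.ofLp tl.ofLp)

/-- The coordinates of a state. -/
def coords : N.State ≃L[ℝ] (Fin nb ⊕ (N.Edge ⊕ Fin nb ⊕ Fin nb) → ℝ) :=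
  LinearEquiv.toContinuousLinearEquiv
    { toFun := fun z => Sum.elim z.1.ofLp (N.mult z.2.1 z.2.2.1 z.2.2.2)
      invFun := fun v => (WithLp.toLp 2 fun k => v (Sum.inl k),
        WithLp.toLp 2 fun e => v (Sum.inr (Sum.inl e)),
        WithLp.toLp 2 fun i => v (Sum.inr (Sum.inr (Sum.inl i))),
        WithLp.toLp 2 fun i => v (Sum.inr (Sum.inr (Sum.inr i))))
      map_add' := fun z z' => by
        funext i
        rcases i with k | e | i | i <;> rfl
      map_smul' := fun r z => by
        funext i
        rcases i with k | e | i | i <;> rfl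
      left_inv := fun z => rfl
      right_inv := fun v => by
        funext i
        rcases i with k | e | i | i <;> rfl }

theorem coords_inl (z : N.State) (k : Fin nb) : N.coords z (Sum.inl k) = z.1 k := rfl

theorem coords_inr (z : N.State) (j : N.Edge ⊕ Fin nb ⊕ Fin nb) :
    N.coords z (Sum.inr j) = N.mult z.2.1 z.2.2.1 z.2.2.2 j := rfl

theorem multNonneg_iff (z : N.State) :
    N.MultNonneg z ↔ ∀ j, 0 ≤ N.mult z.2.1 z.2.2.1 z.2.2.2 j := by
  simp [MultNonneg, mult, Sum.forall]

variable (m : ℕ) (hW : ∀ i, 0 < N.W i) (hσ : ∀ e : N.Edge, 0 < N.σ e.1.1 e.1.2)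

theorem con_edge (P : EuclideanSpace ℝ (Fin nb)) (e : N.Edge) :
    (N.program m hW hσ).con (Sum.inl e) P.ofLp
      = N.flowAt m P e.1.1 e.1.2 ^ 2 - N.σ e.1.1 e.1.2 ^ 2 := by
  have h : dotProduct ((N.program m hW hσ).a (Sum.inl e)) P.ofLp = N.flowAt m P e.1.1 e.1.2 := by
    simp only [program, Sum.elim_inl, flowAt, flow, Matrix.mulVec, dotProduct,
      ← Finset.sum_sub_distrib, Finset.mul_sum]
    exact Finset.sum_congr rfl fun k _ => by ring
  rw [QuadProgram.con, h]
  simp [program, sub_eq_add_neg]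

theorem con_upper (P : EuclideanSpace ℝ (Fin nb)) (i : Fin nb) :
    (N.program m hW hσ).con (Sum.inr (Sum.inl i)) P.ofLp = P i - N.Phi i := by
  simp [QuadProgram.con, program, sub_eq_add_neg]

theorem con_lower (P : EuclideanSpace ℝ (Fin nb)) (i : Fin nb) :
    (N.program m hW hσ).con (Sum.inr (Sum.inr i)) P.ofLp = N.Plo i - P i := by
  simp [QuadProgram.con, program]
  ring

theorem cost_eq (P : EuclideanSpace ℝ (Fin nb)) :
    N.cost P = (N.program m hW hσ).obj P.ofLp := by
  rw [cost, EuclideanSpace.norm_sq_eq]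
  simp [QuadProgram.obj, program, mul_pow]

theorem mem_feasible_iff (P : EuclideanSpace ℝ (Fin nb)) :
    P ∈ N.feasible m ↔ ∀ j, (N.program m hW hσ).con j P.ofLp ≤ 0 := by
  simp only [feasible, Set.mem_ofPred_eq, Sum.forall, con_edge, con_upper, con_lower, sub_nonpos,
    forall_and]
  tauto

theorem lagrangian_eq (P : EuclideanSpace ℝ (Fin nb)) (lam : EuclideanSpace ℝ N.Edge)
    (tu tl : EuclideanSpace ℝ (Fin nb)) :
    N.lagrangian m P lam tu tl = (N.program m hW hσ).lag P.ofLp (N.mult lam tu tl) := by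
  simp only [lagrangian, QuadProgram.lag, ← cost_eq, Fintype.sum_sum_type, con_edge, con_upper,
    con_lower, mult, Sum.elim_inl, Sum.elim_inr, add_assoc]

/-- The Karush-Kuhn-Tucker conditions are sufficient because the Lagrangian is convex in `P` for
nonnegative multipliers. -/
theorem isSaddlePoint_iff (z : N.State) :
    N.IsSaddlePoint m z ↔
      (N.program m hW hσ).IsKKT z.1.ofLp (N.mult z.2.1 z.2.2.1 z.2.2.2) := by
  simp only [IsSaddlePoint, N.lagrangian_eq m hW hσ, multNonneg_iff]
  constructor
  · rintro ⟨h0, h⟩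
    refine QuadProgram.isKKT_of_saddle h0 (fun y' hy' => ?_) fun x' => ?_
    · have := (h (N.coords.symm (Sum.elim z.1.ofLp y')) (fun j => by
        rw [← coords_inr, ContinuousLinearEquiv.apply_symm_apply]
        exact hy' j)).1
      convert! this using 2
      funext j
      rw [← coords_inr, ContinuousLinearEquiv.apply_symm_apply]
      rfl
    · exact (h (WithLp.toLp 2 x', z.2) h0).2
  · intro h
    refine ⟨h.nonneg, fun w hw => ⟨h.lag_le hw, ?_⟩⟩
    have := h.lag_add_wdist_le w.1.ofLp
    linarith [(N.program m hW hσ).wdist_nonneg z.1.ofLp w.1.ofLp]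

theorem gradient_primal (z : N.State) (k : Fin nb) :
    gradient (fun P => N.lagrangian m P z.2.1 z.2.2.1 z.2.2.2) z.1 k
      = (N.program m hW hσ).lagGrad z.1.ofLp (N.mult z.2.1 z.2.2.1 z.2.2.2) k := by
  simp only [N.lagrangian_eq m hW hσ]
  refine gradient_apply_of_hasDerivAt ?_ ?_
  · unfold QuadProgram.lag QuadProgram.obj QuadProgram.con dotProduct
    fun_prop
  · obtain ⟨C, hC⟩ := (N.program m hW hσ).exists_lag_add_single z.1.ofLp
      (N.mult z.2.1 z.2.2.1 z.2.2.2) k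
    convert! hasDerivAt_affine_add_sq ((N.program m hW hσ).lag z.1.ofLp
      (N.mult z.2.1 z.2.2.1 z.2.2.2)) _ C using 2 with t
    rw [← hC t]
    congr 1
    ext i
    simp [Pi.single_apply]

/-- The Lagrangian is affine in the multipliers, hence the quadratic coefficient `0` in the
difference formula. -/
theorem gradient_edge (z : N.State) (e : N.Edge) :
    gradient (fun lam => N.lagrangian m z.1 lam z.2.2.1 z.2.2.2) z.2.1 e
      = (N.program m hW hσ).con (Sum.inl e) z.1.ofLp := by
  classical
  rw [con_edge]
  refine gradient_apply_of_hasDerivAt ?_ ?_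
  · unfold lagrangian
    fun_prop
  · convert! hasDerivAt_affine_add_sq (N.lagrangian m z.1 z.2.1 z.2.2.1 z.2.2.2) _ 0 using 2 with t
    simp only [lagrangian, PiLp.add_apply, PiLp.smul_apply, PiLp.single_apply,
      smul_eq_mul, mul_ite, mul_one, mul_zero, add_mul, ite_mul, zero_mul, Finset.sum_add_distrib,
      Finset.sum_ite_eq', Finset.mem_univ, if_true]
    ring

theorem gradient_upper (z : N.State) (i : Fin nb) :
    gradient (fun tu => N.lagrangian m z.1 z.2.1 tu z.2.2.2) z.2.2.1 i
      = (N.program m hW hσ).con (Sum.inr (Sum.inl i)) z.1.ofLp := by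
  rw [con_upper]
  refine gradient_apply_of_hasDerivAt ?_ ?_
  · unfold lagrangian
    fun_prop
  · convert! hasDerivAt_affine_add_sq (N.lagrangian m z.1 z.2.1 z.2.2.1 z.2.2.2) _ 0 using 2 with t
    simp only [lagrangian, PiLp.add_apply, PiLp.smul_apply, PiLp.single_apply,
      smul_eq_mul, mul_ite, mul_one, mul_zero, add_mul, ite_mul, zero_mul, Finset.sum_add_distrib,
      Finset.sum_ite_eq', Finset.mem_univ, if_true]
    ring

theorem gradient_lower (z : N.State) (i : Fin nb) :
    gradient (fun tl => N.lagrangian m z.1 z.2.1 z.2.2.1 tl) z.2.2.2 i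
      = (N.program m hW hσ).con (Sum.inr (Sum.inr i)) z.1.ofLp := by
  rw [con_lower]
  refine gradient_apply_of_hasDerivAt ?_ ?_
  · unfold lagrangian
    fun_prop
  · convert! hasDerivAt_affine_add_sq (N.lagrangian m z.1 z.2.1 z.2.2.1 z.2.2.2) _ 0 using 2 with t
    simp only [lagrangian, PiLp.add_apply, PiLp.smul_apply, PiLp.single_apply,
      smul_eq_mul, mul_ite, mul_one, mul_zero, add_mul, ite_mul, zero_mul, Finset.sum_add_distrib,
      Finset.sum_ite_eq', Finset.mem_univ, if_true]
    ring

theorem coords_saddleField (z : N.State) :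
    N.coords (N.saddleField m z) = Sum.elim
      (fun k => -(N.program m hW hσ).lagGrad z.1.ofLp (N.mult z.2.1 z.2.2.1 z.2.2.2) k)
      fun j => projPlus ((N.program m hW hσ).con j z.1.ofLp)
        (N.mult z.2.1 z.2.2.1 z.2.2.2 j) := by
  funext i
  rcases i with k | e | i | i
  · rw [coords_inl, Sum.elim_inl, ← gradient_primal]
    rfl
  · rw [coords_inr, Sum.elim_inr, ← gradient_edge]
    rfl
  · rw [coords_inr, Sum.elim_inr, ← gradient_upper]
    rfl
  · rw [coords_inr, Sum.elim_inr, ← gradient_lower]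
    rfl

theorem IsTrajectory.isFlow {z : ℝ → N.State} (hz : N.IsTrajectory m z) :
    (N.program m hW hσ).IsFlow (fun _ => 1) (fun t => (z t).1.ofLp)
      fun t => N.mult (z t).2.1 (z t).2.2.1 (z t).2.2.2 := by
  have hac : ∀ i T, 0 < T → AbsolutelyContinuousOnInterval (fun t => N.coords (z t) i) 0 T := by
    intro i T hT
    exact LipschitzWith.comp_absolutelyContinuousOnInterval
      (g := fun s => ((ContinuousLinearMap.proj i).comp N.coords.toContinuousLinearMap :
        N.State →L[ℝ] ℝ) s) (ContinuousLinearMap.lipschitz _) (hz.absCont T hT)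
  refine ⟨fun k => hac (Sum.inl k), fun j => hac (Sum.inr j),
    fun t ht => (N.multNonneg_iff _).1 (hz.nonneg t ht), ?_⟩
  filter_upwards [hz.ode] with t ht ht0
  have h1 : HasDerivAt (fun s => N.coords (z s)) (N.coords (N.saddleField m (z t))) t :=
    N.coords.toContinuousLinearMap.hasFDerivAt.comp_hasDerivAt t (ht ht0)
  rw [N.coords_saddleField m hW hσ, hasDerivAt_pi] at h1
  simp only [one_mul]
  exact ⟨fun k => h1 (Sum.inl k), fun j => h1 (Sum.inr j)⟩

theorem exists_isTrajectory {x' : Fin nb → ℝ} {y' : N.Edge ⊕ Fin nb ⊕ Fin nb → ℝ}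
    (h : (N.program m hW hσ).IsKKT x' y') (z₀ : N.State) (h₀ : N.MultNonneg z₀) :
    ∃ z, N.IsTrajectory m z ∧ z 0 = z₀ := by
  obtain ⟨u, hu0, ⟨K, hK⟩, hflow⟩ := QuadProgram.exists_isFlow h (N.coords z₀)
    fun j => (N.multNonneg_iff z₀).1 h₀ j
  have hcoords : ∀ t, N.coords (N.coords.symm (u t)) = u t := fun t =>
    N.coords.apply_symm_apply (u t)
  have hprimal : ∀ t, (fun k => u t (Sum.inl k)) = (N.coords.symm (u t)).1.ofLp := fun t => by
    funext k
    rw [← coords_inl, hcoords]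
  have hdual : ∀ t, (fun j => u t (Sum.inr j)) = N.mult (N.coords.symm (u t)).2.1
      (N.coords.symm (u t)).2.2.1 (N.coords.symm (u t)).2.2.2 := fun t => by
    funext j
    rw [← coords_inr, hcoords]
  refine ⟨fun t => N.coords.symm (u t), ⟨fun T hT => ?_, fun t ht => ?_, ?_⟩, ?_⟩
  · have hacu : AbsolutelyContinuousOnInterval u 0 T := by
      refine LipschitzOnWith.absolutelyContinuousOnInterval (hK.mono ?_)
      rw [Set.uIcc_of_le hT.le]
      exact Set.Icc_subset_Ici_self
    exact LipschitzWith.comp_absolutelyContinuousOnInterval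
      (g := fun v => N.coords.symm.toContinuousLinearMap v) (ContinuousLinearMap.lipschitz _) hacu
  · rw [multNonneg_iff, ← hdual]
    exact hflow.nonneg t ht
  · filter_upwards [hflow.ode] with t ht ht0
    have h1 : HasDerivAt u (N.coords (N.saddleField m (N.coords.symm (u t)))) t := by
      rw [N.coords_saddleField m hW hσ, ← hprimal, ← hdual, hasDerivAt_pi]
      rintro (k | j)
      · simpa only [one_mul, Sum.elim_inl, Sum.elim_inr] using (ht ht0).1 k
      · simpa only [one_mul, Sum.elim_inl, Sum.elim_inr] using (ht ht0).2 j
    have h2 := N.coords.symm.toContinuousLinearMap.hasFDerivAt.comp_hasDerivAt t h1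
    have e : N.coords.symm.toContinuousLinearMap
        (N.coords (N.saddleField m (N.coords.symm (u t))))
        = N.saddleField m (N.coords.symm (u t)) := N.coords.symm_apply_apply _
    rw [e] at h2
    exact h2
  · simp only [hu0, ContinuousLinearEquiv.symm_apply_apply]

theorem continuous_pair :
    Continuous fun z : N.State => (z.1.ofLp, N.mult z.2.1 z.2.2.1 z.2.2.2) :=
  ((continuous_pi fun k => (continuous_apply (Sum.inl k)).comp N.coords.continuous).prodMk
    (continuous_pi fun j => (continuous_apply (Sum.inr j)).comp N.coords.continuous) : Continuous
    fun z : N.State => ((fun k => N.coords z (Sum.inl k)), fun j => N.coords z (Sum.inr j)))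

/-- The state with given primal and dual vectors. -/
def ofPair (p : (Fin nb → ℝ) × (N.Edge ⊕ Fin nb ⊕ Fin nb → ℝ)) : N.State :=
  N.coords.symm (Sum.elim p.1 p.2)

theorem continuous_ofPair : Continuous N.ofPair := by
  refine N.coords.symm.continuous.comp (continuous_pi ?_)
  rintro (k | j)
  · simp only [Sum.elim_inl]
    fun_prop
  · simp only [Sum.elim_inr]
    fun_prop

theorem ofPair_pair (z : N.State) : N.ofPair (z.1.ofLp, N.mult z.2.1 z.2.2.1 z.2.2.2) = z :=
  N.coords.symm_apply_apply z

theorem mult_ofPair (p : (Fin nb → ℝ) × (N.Edge ⊕ Fin nb ⊕ Fin nb → ℝ)) :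
    N.mult (N.ofPair p).2.1 (N.ofPair p).2.2.1 (N.ofPair p).2.2.2 = p.2 := by
  funext j
  rw [← coords_inr, ofPair, ContinuousLinearEquiv.apply_symm_apply]
  rfl

end PowerGrid

/-! ### Optimality, existence, convergence and stability for the power network -/

theorem proposition4 {nb n : ℕ} (N : PowerGrid nb n) (m : ℕ)
    (hW : ∀ i, 0 < N.W i)
    (hσ : ∀ e : N.Edge, 0 < N.σ e.1.1 e.1.2)
    (hfeas : (N.feasible m).Nonempty) :
    ∃ Pstar : EuclideanSpace ℝ (Fin nb),
      -- `Pstar` is the unique optimal solution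
      (N.IsOptimal m Pstar ∧ ∀ Q, N.IsOptimal m Q → Q = Pstar) ∧
      -- from every initial state there is a solution for all times
      (∀ z₀ : N.State, N.MultNonneg z₀ → ∃ z, N.IsTrajectory m z ∧ z 0 = z₀) ∧
      -- every solution converges to a saddle point whose power vector is `Pstar`
      (∀ z, N.IsTrajectory m z →
        ∃ zstar : N.State, zstar.1 = Pstar ∧ N.IsSaddlePoint m zstar ∧
          Filter.Tendsto z Filter.atTop (nhds zstar)) ∧
      -- every saddle point is Lyapunov stable
      (∀ zstar : N.State, N.IsSaddlePoint m zstar →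
        ∀ ε > 0, ∃ δ > 0, ∀ z, N.IsTrajectory m z → dist (z 0) zstar < δ →
          ∀ t, 0 ≤ t → dist (z t) zstar < ε) := by
  obtain ⟨P, hP⟩ := hfeas
  obtain ⟨x', hx', hmin⟩ := (N.program m hW hσ).exists_isMinOn
    ((N.mem_feasible_iff m hW hσ P).1 hP)
  obtain ⟨y', hK⟩ := QuadProgram.exists_isKKT_of_isMinOn hx' hmin
  have hopt : N.IsOptimal m (WithLp.toLp 2 x') := by
    refine ⟨(N.mem_feasible_iff m hW hσ _).2 hx', fun Q hQ => ?_⟩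
    simp only [Set.mem_ofPred_eq, N.cost_eq m hW hσ]
    exact hmin _ ((N.mem_feasible_iff m hW hσ Q).1 hQ)
  refine ⟨WithLp.toLp 2 x', ⟨hopt, fun Q hQ => ?_⟩, N.exists_isTrajectory m hW hσ hK,
    fun z hz => ?_, fun zs hzs ε hε => ?_⟩
  -- Every feasible point costs more than the optimum by at least its weighted squared distance to
  -- it, whence uniqueness.
  · have h1 := hK.obj_add_wdist_le ((N.mem_feasible_iff m hW hσ Q).1 hQ.1)
    have h2 : N.cost Q ≤ N.cost (WithLp.toLp 2 x') := hQ.2 hopt.1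
    rw [N.cost_eq m hW hσ, N.cost_eq m hW hσ] at h2
    have h3 : Q.ofLp = x' := (N.program m hW hσ).eq_of_wdist_nonpos (by linarith)
    rw [← h3]
  · obtain ⟨y'', hK'', hlim⟩ := (hz.isFlow N m hW hσ).exists_tendsto hK
    refine ⟨N.ofPair (x', y''), rfl, ?_, ?_⟩
    · rw [N.isSaddlePoint_iff m hW hσ, N.mult_ofPair]
      exact hK''
    · have := (N.continuous_ofPair.tendsto _).comp hlim
      simpa only [Function.comp_def, N.ofPair_pair] using this
  · have hKs := (N.isSaddlePoint_iff m hW hσ zs).1 hzs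
    -- The energy bounds distances in coordinates. Continuity of `ofPair` carries the bound back to
    -- states, and continuity of the square root of the energy makes it small for nearby initial
    -- states.
    obtain ⟨η, hη, hη'⟩ := Metric.continuous_iff.1 N.continuous_ofPair
      (zs.1.ofLp, N.mult zs.2.1 zs.2.2.1 zs.2.2.2) ε hε
    have hE := (Real.continuous_sqrt.comp ((QuadProgram.continuous_energy zs.1.ofLp
      (N.mult zs.2.1 zs.2.2.1 zs.2.2.2)).comp N.continuous_pair))
    obtain ⟨δ, hδ, hδ'⟩ := Metric.continuous_iff.1 hE zs η hη
    refine ⟨δ, hδ, fun z hz hz0 t ht => ?_⟩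
    have h1 := hδ' (z 0) hz0
    have h2 := (hz.isFlow N m hW hσ).mem_closedBall (fun _ _ => zero_le_one) hKs ht
    have h3 := hη' _ (lt_of_le_of_lt h2 (by
      simpa [Real.dist_eq, QuadProgram.energy, abs_of_nonneg (Real.sqrt_nonneg _)] using h1))
    rwa [N.ofPair_pair, N.ofPair_pair] at h3

end
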